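/- Let $F$ be a totally real number field of degree $m$ with ring of integers $\mathcal{O}_F$, let $\mathfrak{n}$ be a nonzero ideal of $\mathcal{O}_F$, and let $k=(k_1,\dots,k_m)$ be a weight with all $k_j$ even and $k_j\ge 2$; put $k_0=\max_j k_j$. Let $\mathfrak{S}_k(\mathfrak{n})=\prod_{\nu} S_k(\Gamma_\nu(\mathfrak{n}))$ be the space of Hilbert cusp forms of weight $k$ and level $\mathfrak{n}$, where $\nu$ runs over the narrow ideal classes of $F$, $\mathfrak{t}_\nu$ is a fractional ideal representing $\nu$, and, with $\mathfrak{D}_F$ the different of $F$, $\Gamma_\nu(\mathfrak{n})$ is the group of matrices $\begin{pmatrix}a&b\\c&d\end{pmatrix}$ with $a,d\in\mathcal{O}_F$, $b\in(\mathfrak{t}_\nu\mathfrak{D}_F)^{-1}$, $c\in\mathfrak{n}\mathfrak{t}_\nu\mathfrak{D}_F$ and totally positive determinant $ad-bc\in\mathcal{O}_F^\times$. For $\mathbf{f}=(f_\nu)_\nu\in\mathfrak{S}_k(\mathfrak{n})$ with $f_\nu(\tau)=\sum_{0\ll\xi\in\mathfrak{t}_\nu}a_\nu(\xi)\,e^{2\pi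 i\sum_j\xi_j\tau_j}$ and a nonzero integral ideal $\mathfrak{m}=\xi\mathfrak{t}_\nu^{-1}$, $\xi\gg0$, put $$C_{\mathbf f}(\mathfrak{m})=a_\nu(\xi)\prod_j\xi_j^{-k_j/2}\,\mathrm{N}(\mathfrak{m})^{k_0/2},\qquad c_{\mathbf f}(\mathfrak{m})=\frac{C_{\mathbf f}(\mathfrak{m})}{\mathrm{N}(\mathfrak{m})^{(k_0-1)/2}} .$$ Let $\mathbf f$ be a primitive form of weight $k$ and level $\mathfrak{n}$ with trivial character; that is, $\mathbf f\in\mathfrak{S}_k(\mathfrak{n})$ is orthogonal, for the Petersson product, to all forms coming from levels properly dividing $\mathfrak{n}$, is an eigenfunction of all Hecke operators $T_{\mathfrak{m}}$, is normalized by $C_{\mathbf f}(\mathcal{O}_F)=1$, and, as a function on $\mathrm{GL}_2(\mathbb{A}_F)$, is invariant under the centre $\mathbb{A}_F^\times$. Let $\mathfrak{p}\nmid\mathfrak{n}$ be a nonzero prime ideal and let $\theta_{\mathfrak p}\in[0,\pi]$ be its Hecke eigenangle, defined by $c_{\mathbf f}(\mathfrak{p})=2\cos\theta_{\mathfrak p}$.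 Write $\|x\|$ for the distance from $x$ to the nearest integer, and suppose that $\theta_{\mathfrak p}/\pi$ is badly approximable, i.e. that there is $\eta>0$ with $$\Bigl\|q\,\frac{\theta_{\mathfrak p}}{\pi}\Bigr\|>\frac{\eta}{q}\qquad\text{for all integers } q\ge1. \tag{1}$$ Then there is a constant $\eta_{\mathbf f}>0$, independent of $n$, such that $$|c_{\mathbf f}(\mathfrak{p}^n)|>\frac{\eta_{\mathbf f}}{n+1}\qquad\text{for every integer } n\ge1 .$$ More precisely, every $\eta>0$ that satisfies (1) can be taken as $\eta_{\mathbf f}$. -/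

import Mathlib

open NumberField UpperHalfPlane MeasureTheory
open scoped nonZeroDivisors MatrixGroups ComplexConjugate

noncomputable section

namespace HilbertForm

section totallyPositive

variable {F : Type*} [Field F]

/-- `x ≫ 0`. -/
def TotPos (x : F) : Prop := ∀ σ : F →+* ℝ, 0 < σ x

lemma TotPos.mul {x y : F} (hx : TotPos x) (hy : TotPos y) : TotPos (x * y) := fun σ => by
  rw [map_mul]; exact mul_pos (hx σ) (hy σ)

lemma TotPos.inv {x : F} (hx : TotPos x) : TotPos x⁻¹ := fun σ => by
  rw [map_inv₀]; exact inv_pos.mpr (hx σ)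

end totallyPositive

variable (F : Type*) [Field F] [NumberField F]

/-- The `m`-fold product of upper half planes, one factor for each real embedding of `F`
(there are `m = [F : ℚ]` of them when `F` is totally real). -/
abbrev HalfSpace : Type _ := (F →+* ℝ) → ℍ

/-- The group of totally positive elements of `Fˣ`. -/
def totPosUnits : Subgroup Fˣ where
  carrier := {x | TotPos (x : F)}
  mul_mem' {x y} hx hy := by
    have h := TotPos.mul (x := (x : F)) (y := (y : F)) hx hy
    simpa using h
  one_mem' σ := by simp
  inv_mem' {x} hx := by
    have h := TotPos.inv (x := (x : F)) hx
    simpa using h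

/-- The narrow class group: fractional ideals modulo principal ideals with a totally positive
generator. -/
abbrev NarrowClassGroup : Type _ :=
  (FractionalIdeal (𝓞 F)⁰ F)ˣ ⧸ (totPosUnits F).map (toPrincipalIdeal (𝓞 F) F)

/-- The different of `F`, as a fractional ideal. -/
def different : FractionalIdeal (𝓞 F)⁰ F := (differentIdeal ℤ (𝓞 F) : Ideal (𝓞 F))

variable {F}

lemma different_ne_zero : different F ≠ 0 :=
  FractionalIdeal.coeIdeal_ne_zero.mpr (by
    simpa using (differentIdeal_ne_bot (A := ℤ) (B := 𝓞 F)))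

/-- The congruence subgroup `Γ(𝔱, 𝔫)` of `GL₂⁺(F)`: matrices with diagonal entries in `𝓞`, upper
right entry in `(𝔱𝔇)⁻¹`, lower left entry in `𝔫𝔇𝔱` and totally positive determinant in `𝓞ˣ`. -/
def Gamma (𝔱 : (FractionalIdeal (𝓞 F)⁰ F)ˣ) (𝔫 : Ideal (𝓞 F)) : Subgroup (GL (Fin 2) F) where
  carrier := {γ | TotPos γ.1.det ∧ FractionalIdeal.spanSingleton (𝓞 F)⁰ γ.1.det = 1 ∧
    γ.1 0 0 ∈ (1 : FractionalIdeal (𝓞 F)⁰ F) ∧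
    γ.1 0 1 ∈ ((𝔱 : FractionalIdeal (𝓞 F)⁰ F) * different F)⁻¹ ∧
    γ.1 1 0 ∈ (𝔫 : FractionalIdeal (𝓞 F)⁰ F) * (𝔱 * different F) ∧
    γ.1 1 1 ∈ (1 : FractionalIdeal (𝓞 F)⁰ F)}
  mul_mem' {x y} := by
    rintro ⟨h1, h2, h3, h4, h5, h6⟩ ⟨k1, k2, k3, k4, k5, k6⟩
    have hI : (𝔱 : FractionalIdeal (𝓞 F)⁰ F) * different F ≠ 0 :=
      mul_ne_zero 𝔱.ne_zero different_ne_zero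
    generalize (𝔱 : FractionalIdeal (𝓞 F)⁰ F) * different F = I at *
    have hle : (𝔫 : FractionalIdeal (𝓞 F)⁰ F) ≤ 1 := FractionalIdeal.coeIdeal_le_one
    have e1 : I⁻¹ * ((𝔫 : FractionalIdeal (𝓞 F)⁰ F) * I) = 𝔫 := by field_simp
    have e2 : ((𝔫 : FractionalIdeal (𝓞 F)⁰ F) * I) * I⁻¹ = 𝔫 := by field_simp
    simp only [Set.mem_ofPred_eq, Units.val_mul, Matrix.det_mul, Matrix.mul_apply,
      Fin.sum_univ_two]
    refine ⟨h1.mul k1, ?_, ?_, ?_, ?_, ?_⟩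
    · rw [← FractionalIdeal.spanSingleton_mul_spanSingleton, h2, k2, one_mul]
    · exact (1 : FractionalIdeal (𝓞 F)⁰ F).1.add_mem
        (by simpa using FractionalIdeal.mul_mem_mul h3 k3)
        (hle (e1 ▸ FractionalIdeal.mul_mem_mul h4 k5))
    · exact (I⁻¹).1.add_mem
        (by simpa using FractionalIdeal.mul_mem_mul h3 k4)
        (by simpa using FractionalIdeal.mul_mem_mul h4 k6)
    · exact ((𝔫 : FractionalIdeal (𝓞 F)⁰ F) * I).1.add_mem
        (mul_one ((𝔫 : FractionalIdeal (𝓞 F)⁰ F) * I) ▸ FractionalIdeal.mul_mem_mul h5 k3)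
        (one_mul ((𝔫 : FractionalIdeal (𝓞 F)⁰ F) * I) ▸ FractionalIdeal.mul_mem_mul h6 k5)
    · exact (1 : FractionalIdeal (𝓞 F)⁰ F).1.add_mem
        (hle (e2 ▸ FractionalIdeal.mul_mem_mul h5 k4))
        (by simpa using FractionalIdeal.mul_mem_mul h6 k6)
  one_mem' := by
    refine ⟨fun σ => by simp, by simp, ?_, ?_, ?_, ?_⟩
    · simp
    · simpa using FractionalIdeal.zero_mem _
    · simpa using FractionalIdeal.zero_mem _
    · simp
  inv_mem' {x} := by
    rintro ⟨h1, h2, h3, h4, h5, h6⟩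
    have hd : (x.1.det)⁻¹ ∈ (1 : FractionalIdeal (𝓞 F)⁰ F) := by
      have h := FractionalIdeal.mem_spanSingleton_self (𝓞 F)⁰ (x.1.det)⁻¹
      rwa [← FractionalIdeal.spanSingleton_inv, h2, inv_one] at h
    have key : ∀ (J : FractionalIdeal (𝓞 F)⁰ F) (y : F), y ∈ J → (x.1.det)⁻¹ * y ∈ J :=
      fun J y hy => by simpa using FractionalIdeal.mul_mem_mul hd hy
    have neg : ∀ (J : FractionalIdeal (𝓞 F)⁰ F) (y : F), y ∈ J → -y ∈ J :=
      fun J y hy => J.1.neg_mem hy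
    have hx : (x⁻¹).1 = (x.1.det)⁻¹ • x.1.adjugate := by
      rw [Matrix.coe_units_inv, Matrix.inv_def, Ring.inverse_eq_inv']
    have hdet : (x⁻¹).1.det = (x.1.det)⁻¹ := by
      rw [Matrix.coe_units_inv, Matrix.det_nonsing_inv, Ring.inverse_eq_inv']
    refine ⟨?_, ?_, ?_, ?_, ?_, ?_⟩
    · rw [hdet]; exact h1.inv
    · rw [hdet, ← FractionalIdeal.spanSingleton_inv, h2, inv_one]
    · rw [hx, Matrix.adjugate_fin_two]; simpa using key _ _ h6
    · rw [hx, Matrix.adjugate_fin_two]; simpa using neg _ _ (key _ _ h4)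
    · rw [hx, Matrix.adjugate_fin_two]; simpa using neg _ _ (key _ _ h5)
    · rw [hx, Matrix.adjugate_fin_two]; simpa using key _ _ h3

/-- The action of `GL₂⁺(F)` on the product of upper half planes by fractional linear
transformations in every coordinate. -/
def moebius (β : GL (Fin 2) F) (τ : HalfSpace F) : HalfSpace F :=
  fun σ => Matrix.GeneralLinearGroup.map σ β • τ σ

/-- The slash operator `(f ‖ₖ β)(τ) = (det β)^{k/2} (cτ + d)^{-k} f(β τ)`, used for `β` with
totally positive determinant. -/
def slash (k : (F →+* ℝ) → ℕ) (f : HalfSpace F → ℂ) (β : GL (Fin 2) F) : HalfSpace F → ℂ :=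
  fun τ => (∏ σ : F →+* ℝ, (((σ β.1.det) ^ ((k σ : ℝ) / 2) : ℝ) : ℂ)) *
    (∏ σ : F →+* ℝ, ((σ (β.1 1 0) : ℂ) * (τ σ : ℂ) + (σ (β.1 1 1) : ℂ)) ^ k σ)⁻¹ *
    f (moebius β τ)

/-- Holomorphy of a function on the product of upper half planes. -/
def IsHolomorphic (f : HalfSpace F → ℂ) : Prop :=
  DifferentiableOn ℂ (fun z : (F →+* ℝ) → ℂ => f (fun σ => UpperHalfPlane.ofComplex (z σ)))
    {z | ∀ σ, 0 < (z σ).im}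

/-- `exp(2πi ∑ⱼ ξⱼ τⱼ)`. -/
def expTrace (ξ : F) (τ : HalfSpace F) : ℂ :=
  Complex.exp (2 * Real.pi * Complex.I * ∑ σ : F →+* ℝ, (σ ξ : ℂ) * (τ σ : ℂ))

/-- `f(τ) = ∑ a(ξ) exp(2πi ∑ⱼ ξⱼ τⱼ)`, an absolutely convergent sum over the elements `ξ` of some
fractional ideal (`a` is extended by zero to `F`). -/
def HasFourierExpansion (f : HalfSpace F → ℂ) (a : F → ℂ) : Prop :=
  (∃ L : FractionalIdeal (𝓞 F)⁰ F, ∀ ξ, a ξ ≠ 0 → ξ ∈ L) ∧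
    ∀ τ, HasSum (fun ξ : F => a ξ * expTrace ξ τ) (f τ)

open Classical in
/-- The Fourier coefficient of `f` at `ξ` (with value `0` if `f` has no Fourier expansion). -/
def fourierCoeff (f : HalfSpace F → ℂ) (ξ : F) : ℂ :=
  if h : ∃ a, HasFourierExpansion f a then h.choose ξ else 0

/-- `f ∈ M_k(Γ)`: holomorphic, invariant under `Γ`, and holomorphic at the cusps. -/
structure IsModularForm (k : (F →+* ℝ) → ℕ) (Γ : Subgroup (GL (Fin 2) F))
    (f : HalfSpace F → ℂ) : Prop where
  holo : IsHolomorphic f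
  slash_eq : ∀ γ ∈ Γ, slash k f γ = f
  holo_cusps : ∀ α : GL (Fin 2) F, TotPos α.1.det →
    ∃ a, HasFourierExpansion (slash k f α) a ∧ ∀ ξ, a ξ ≠ 0 → ξ = 0 ∨ TotPos ξ

/-- `f ∈ S_k(Γ)`: the constant term of `f ‖ₖ α` vanishes for all `α ∈ GL₂⁺(F)`. -/
structure IsCuspForm (k : (F →+* ℝ) → ℕ) (Γ : Subgroup (GL (Fin 2) F))
    (f : HalfSpace F → ℂ) : Prop extends IsModularForm k Γ f where
  zero_at_cusps : ∀ α : GL (Fin 2) F, TotPos α.1.det → fourierCoeff (slash k f α) 0 = 0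

/-- A collection `(f_ν)` of functions indexed by the narrow ideal classes. -/
abbrev Family (F : Type*) [Field F] [NumberField F] : Type _ :=
  NarrowClassGroup F → HalfSpace F → ℂ

/-- `t` selects a fractional ideal `t ν` in each narrow ideal class `ν`. -/
def IsRepresentatives (t : NarrowClassGroup F → (FractionalIdeal (𝓞 F)⁰ F)ˣ) : Prop :=
  ∀ ν, QuotientGroup.mk (t ν) = ν

section adelic

variable (t : NarrowClassGroup F → (FractionalIdeal (𝓞 F)⁰ F)ˣ) (k : (F →+* ℝ) → ℕ)
  (𝔫 : Ideal (𝓞 F))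

/-- `𝐟 ∈ 𝔖_k(𝔫) = ∏_ν S_k(Γ_ν(𝔫))`. -/
def IsHilbertCuspForm (f : Family F) : Prop := ∀ ν, IsCuspForm k (Gamma (t ν) 𝔫) (f ν)

/-- The part of `GL₂⁺(F)` over which the centre of `GL₂(𝔸_F)` acts. If `z` is a finite idele with
ideal `𝔷` and `x_ν = diag(t_ν⁻¹, 1)`, this is the set of the `γ^ι` (main involution) for
`γ ∈ GL₂⁺(F)` with `γ x_μ ∈ x_ν z K₀(𝔫)`. -/
def centralSet (𝔷 : (FractionalIdeal (𝓞 F)⁰ F)ˣ) (ν μ : NarrowClassGroup F) :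
    Set (GL (Fin 2) F) :=
  {β | TotPos β.1.det ∧
    FractionalIdeal.spanSingleton (𝓞 F)⁰ β.1.det = 
      (𝔷 * 𝔷 * t μ * (t ν)⁻¹ : (FractionalIdeal (𝓞 F)⁰ F)ˣ) ∧
    β.1 0 0 ∈ (𝔷 : FractionalIdeal (𝓞 F)⁰ F) ∧
    β.1 0 1 ∈ (𝔷 : FractionalIdeal (𝓞 F)⁰ F) * ((t ν : FractionalIdeal (𝓞 F)⁰ F) * different F)⁻¹ ∧
    β.1 1 0 ∈ (𝔷 : FractionalIdeal (𝓞 F)⁰ F) * ((𝔫 : FractionalIdeal (𝓞 F)⁰ F) *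
      (t μ * different F)) ∧
    β.1 1 1 ∈ ((𝔷 * t μ * (t ν)⁻¹ : (FractionalIdeal (𝓞 F)⁰ F)ˣ) : FractionalIdeal (𝓞 F)⁰ F)}

/-- `𝐟` has trivial character: as a function on `GL₂(𝔸_F)` it is invariant under the centre
`𝔸_Fˣ`. -/
def HasTrivialCharacter (f : Family F) : Prop :=
  ∀ (𝔷 : (FractionalIdeal (𝓞 F)⁰ F)ˣ) (ν μ : NarrowClassGroup F),
    ∀ β ∈ centralSet t 𝔫 𝔷 ν μ, slash k (f μ) β = f ν

/-- The matrices over which the `ν`-th component of `T_𝔪 𝐟` is summed: entries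
`a ∈ 𝓞` prime to `𝔫`, `b ∈ (t_ν𝔇)⁻¹`, `c ∈ 𝔫𝔇t_μ`, `d ∈ t_μt_ν⁻¹` and totally positive determinant
generating `𝔪t_μt_ν⁻¹`. It is nonempty only for the one `μ` such that `𝔪t_μt_ν⁻¹` is trivial in the
narrow class group. -/
def heckeSet (𝔪 : Ideal (𝓞 F)) (ν μ : NarrowClassGroup F) : Set (GL (Fin 2) F) :=
  {β | TotPos β.1.det ∧
    FractionalIdeal.spanSingleton (𝓞 F)⁰ β.1.det =
      (𝔪 : FractionalIdeal (𝓞 F)⁰ F) * (t μ * (t ν)⁻¹ : (FractionalIdeal (𝓞 F)⁰ F)ˣ) ∧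
    (∃ a : 𝓞 F, β.1 0 0 = (a : F) ∧ Ideal.span {a} ⊔ 𝔫 = ⊤) ∧
    β.1 0 1 ∈ ((t ν : FractionalIdeal (𝓞 F)⁰ F) * different F)⁻¹ ∧
    β.1 1 0 ∈ (𝔫 : FractionalIdeal (𝓞 F)⁰ F) * (t μ * different F) ∧
    β.1 1 1 ∈ ((t μ * (t ν)⁻¹ : (FractionalIdeal (𝓞 F)⁰ F)ˣ) : FractionalIdeal (𝓞 F)⁰ F)}

/-- `k₀ = max_j k_j`. -/
def maxWeight (k : (F →+* ℝ) → ℕ) : ℕ := Finset.univ.sup k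

/-- The Hecke operator `T_𝔪` of level `𝔫`:
`(T_𝔪 𝐟)_ν = N(𝔪)^{k₀/2 - 1} ∑_β f_μ ‖ₖ β`, with `β` running over the cosets
`Γ_μ(𝔫) \ heckeSet`. All sums are finite. -/
def hecke (𝔪 : Ideal (𝓞 F)) (f : Family F) : Family F := fun ν τ =>
  (((Ideal.absNorm 𝔪 : ℝ) ^ ((maxWeight k : ℝ) / 2 - 1) : ℝ) : ℂ) *
    ∑ᶠ μ : NarrowClassGroup F,
      ∑ᶠ q ∈ (Quotient.mk (QuotientGroup.rightRel (Gamma (t μ) 𝔫))) '' heckeSet t 𝔫 𝔪 ν μ,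
        slash k (f μ) (Quotient.out q) τ

open Classical in
/-- `C_𝐟(𝔪) = a_ν(ξ) ξ^{-k/2} N(𝔪)^{k₀/2}`, where `𝔪 = ξ t_ν⁻¹` with `ξ ≫ 0`. -/
def coeffC (f : Family F) (𝔪 : Ideal (𝓞 F)) : ℂ :=
  if h : ∃ x : NarrowClassGroup F × F, TotPos x.2 ∧
      (𝔪 : FractionalIdeal (𝓞 F)⁰ F) =
        FractionalIdeal.spanSingleton (𝓞 F)⁰ x.2 * ((t x.1)⁻¹ : (FractionalIdeal (𝓞 F)⁰ F)ˣ)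
  then
    fourierCoeff (f h.choose.1) h.choose.2 *
      (∏ σ : F →+* ℝ, (((σ h.choose.2) ^ (-(k σ : ℝ) / 2) : ℝ) : ℂ)) *
      (((Ideal.absNorm 𝔪 : ℝ) ^ ((maxWeight k : ℝ) / 2) : ℝ) : ℂ)
  else 0

/-- The normalized coefficient `c_𝐟(𝔪) = C_𝐟(𝔪) / N(𝔪)^{(k₀-1)/2}`. -/
def normCoeff (f : Family F) (𝔪 : Ideal (𝓞 F)) : ℂ :=
  coeffC t k f 𝔪 / (((Ideal.absNorm 𝔪 : ℝ) ^ (((maxWeight k : ℝ) - 1) / 2) : ℝ) : ℂ)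

/-- `D` is a (strict, Borel) fundamental domain for the action of `Γ`. -/
def IsFundDomain (Γ : Subgroup (GL (Fin 2) F)) (D : Set (HalfSpace F)) : Prop :=
  MeasurableSet D ∧ ∀ τ, ∃! τ', τ' ∈ D ∧ ∃ γ ∈ Γ, τ' = moebius γ τ

/-- The Petersson product `∑_ν ∫_{Γ_ν \ ℍ^m} f_ν(τ) conj(g_ν(τ)) y^k dμ(τ)`, computed with
fundamental domains `D ν` for `Γ_ν`; `dμ` is the product of the hyperbolic measures `dx dy / y²`. -/
def petersson (D : NarrowClassGroup F → Set (HalfSpace F)) (f g : Family F) : ℂ :=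
  ∑ᶠ ν : NarrowClassGroup F,
    ∫ τ in D ν, f ν τ * conj (g ν τ) * ∏ σ : F →+* ℝ, (((τ σ).im ^ k σ : ℝ) : ℂ)

/-- `𝐡` is obtained from `𝐠` by the level raising operator of `𝔞`, up to a constant:
`h_ν(τ)` is `g_μ ‖ₖ diag(1, ξ)`, where `ξ ≫ 0` generates `t_μ t_ν⁻¹ 𝔞⁻¹`; thus `C_𝐡(𝔪)` is
proportional to `C_𝐠(𝔞⁻¹𝔪)`. -/
def IsLevelRaise (𝔞 : Ideal (𝓞 F)) (g h : Family F) : Prop :=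
  ∀ (ν μ : NarrowClassGroup F) (ξ : Fˣ), TotPos (ξ : F) →
    FractionalIdeal.spanSingleton (𝓞 F)⁰ (ξ : F) * ((t ν : FractionalIdeal (𝓞 F)⁰ F) * 𝔞) = t μ →
    h ν = slash k (g μ) (Matrix.GeneralLinearGroup.mkOfDetNeZero !![1, 0; 0, (ξ : F)] (by simp))

/-- `𝔖_k^old(𝔫)`: the span of the forms that come from lower levels. -/
def oldSpace : Submodule ℂ (Family F) :=
  Submodule.span ℂ {h | ∃ (𝔠 𝔞 : Ideal (𝓞 F)) (g : Family F), 𝔠 * 𝔞 ∣ 𝔫 ∧ 𝔠 ≠ 𝔫 ∧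
    IsHilbertCuspForm t k 𝔠 g ∧ IsLevelRaise t k 𝔞 g h}

/-- `𝐟 ∈ 𝔖_k^new(𝔫)`: orthogonal to the old forms for the Petersson product. -/
def IsNewform (f : Family F) : Prop :=
  IsHilbertCuspForm t k 𝔫 f ∧ ∀ h ∈ oldSpace t k 𝔫,
    ∀ D, (∀ ν, IsFundDomain (Gamma (t ν) 𝔫) (D ν)) → petersson k D f h = 0

/-- `𝐟 ∈ 𝓕_k(𝔫)`: a primitive form of weight `k` and level `𝔫` (with trivial character), that is, a
new form which is an eigenfunction of all Hecke operators and satisfies `C_𝐟(𝓞) = 1`. -/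
structure IsPrimitive (f : Family F) : Prop where
  new : IsNewform t k 𝔫 f
  trivial_character : HasTrivialCharacter t k 𝔫 f
  eigen : ∀ 𝔪 : Ideal (𝓞 F), 𝔪 ≠ ⊥ → ∃ c : ℂ, hecke t k 𝔫 𝔪 f = c • f
  normalized : coeffC t k f ⊤ = 1

/-- `θ = θ_𝔭 ∈ [0, π]` is the Hecke eigenangle at `𝔭`: `c_𝐟(𝔭) = 2 cos θ`. -/
def IsHeckeAngle (f : Family F) (𝔭 : Ideal (𝓞 F)) (θ : ℝ) : Prop :=
  θ ∈ Set.Icc 0 Real.pi ∧ normCoeff t k f 𝔭 = ((2 * Real.cos θ : ℝ) : ℂ)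

end adelic

/-- `‖x‖`, the distance from `x` to the nearest integer. -/
def distInt (x : ℝ) : ℝ := |x - round x|

/-- `η > 0` and `‖q α‖ > η / q` for all positive integers `q`. -/
def IsBadApproxConst (η α : ℝ) : Prop := 0 < η ∧ ∀ q : ℕ, 1 ≤ q → η / q < distInt (q * α)

/-- `α` is badly approximable. -/
def BadlyApproximable (α : ℝ) : Prop := ∃ η, IsBadApproxConst η α

end HilbertForm

end

namespace HilbertForm

/-! ### Mean values of trigonometric series -/

section AlmostPeriodic

open Filter Topology

/-! At a prime `𝔭 ∤ 𝔫` the normalized coefficients satisfy the Chebyshev recursion c(𝔭^(n+2)) = c(𝔭)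
c(𝔭^(n+1)) - c(𝔭^n) with c(𝓞) = 1 and c(𝔭) = 2 cos θ, so sin θ · c(𝔭^n) = sin((n+1)θ). Since |sin θ|
≤ 1 and |sin πx| ≥ 2‖x‖, it follows that |c(𝔭^n)| ≥ 2‖(n+1)θ/π‖, and bad approximability with q =
n+1 gives the bound.

Almost all the work is the recursion (`IsPrimitive.normCoeff_recursion`), derived from the
definition of `T_𝔭` as a sum over cosets. Put J = (t_ν𝔇)⁻¹. The cosets are those of the upper
triangular matrices (1, b; 0, δ) with b in J/𝔭J, and one more coset of matrices whose first column
is divisible by 𝔭. The trivial character turns the latter into diag(1, ε) acting on another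
component (`hecke_eq`).

Each of these matrices acts explicitly on Fourier series. As J is the trace dual of t_ν, all the
exponentials at a frequency in t_ν equal 1, and the sum over b contributes a factor N(𝔭). Uniqueness
of Fourier expansions (`hasSum_expTrace_unique`) then turns the eigenvalue equation into a
three-term relation between coefficients (`eigenvalue_mul_weightedCoeff`), to be read along
generators of 𝔭^n t_ν. -/

lemma tendsto_average_exp {r : ℝ} (hr : r ≠ 0) :
    Tendsto (fun T : ℝ => (T : ℂ)⁻¹ * ∫ s in (0 : ℝ)..T, Complex.exp (Complex.I * r * s))
      atTop (𝓝 0) := by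
  have hc : Complex.I * r ≠ 0 := mul_ne_zero Complex.I_ne_zero (by exact_mod_cast hr)
  simp_rw [integral_exp_mul_complex hc]
  refine squeeze_zero_norm' (a := fun T : ℝ => T⁻¹ * (2 / |r|)) ?_ ?_
  · filter_upwards [eventually_gt_atTop 0] with T hT
    rw [norm_mul, norm_inv, Complex.norm_real, Real.norm_of_nonneg hT.le, norm_div, norm_mul,
      Complex.norm_I, one_mul, Complex.norm_real, Real.norm_eq_abs]
    gcongr
    refine (norm_sub_le _ _).trans ?_
    have h (s : ℝ) : ‖Complex.exp (Complex.I * r * s)‖ = 1 := by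
      rw [show Complex.I * r * s = ((r * s : ℝ) : ℂ) * Complex.I by push_cast; ring]
      exact Complex.norm_exp_ofReal_mul_I _
    rw [h, h]; norm_num
  · simpa using tendsto_inv_atTop_zero.mul_const (2 / |r|)

/-- An absolutely convergent trigonometric series with distinct frequencies that vanishes
identically has zero coefficients. -/
lemma eq_zero_of_hasSum_exp {ι : Type*} [Countable ι] {d : ι → ℂ} {φ : ι → ℝ}
    (hφ : Function.Injective φ) (hd : Summable d)
    (h : ∀ s : ℝ, HasSum (fun i => d i * Complex.exp (Complex.I * φ i * s)) 0) (j : ι) :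
    d j = 0 := by
  classical
  have hnorm (r s : ℝ) : ‖Complex.exp (Complex.I * r * s)‖ = 1 := by
    rw [show Complex.I * r * s = ((r * s : ℝ) : ℂ) * Complex.I by push_cast; ring]
    exact Complex.norm_exp_ofReal_mul_I _
  -- Bohr's argument: shift the j-th frequency to 0 and average over [0, T]. As T → ∞ only the j-th
  -- term survives.
  have h0 (s : ℝ) : HasSum (fun i => d i * Complex.exp (Complex.I * (φ i - φ j : ℝ) * s)) 0 := by
    have := (h s).mul_right (Complex.exp (-(Complex.I * φ j * s)))
    rw [zero_mul] at this
    refine this.congr_fun fun i => ?_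
    rw [mul_assoc (d i), ← Complex.exp_add]
    congr 2
    push_cast; ring
  have hint (T : ℝ) : HasSum (fun i => d i *
      ∫ s in (0 : ℝ)..T, Complex.exp (Complex.I * (φ i - φ j : ℝ) * s)) 0 := by
    have := intervalIntegral.hasSum_integral_of_dominated_convergence (μ := volume)
      (a := 0) (b := T) (f := fun _ => (0 : ℂ))
      (F := fun i (s : ℝ) => d i * Complex.exp (Complex.I * (φ i - φ j : ℝ) * s))
      (fun i _ => ‖d i‖)
      (fun i => (by fun_prop : Continuous _).aestronglyMeasurable)
      (fun i => .of_forall fun s _ => by rw [norm_mul, hnorm, mul_one])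
      (.of_forall fun s _ => hd.norm) (by simp)
      (.of_forall fun s _ => h0 s)
    simpa only [intervalIntegral.integral_const_mul, intervalIntegral.integral_zero] using this
  have hlim := tendsto_tsum_of_dominated_convergence (𝓕 := (atTop : Filter ℝ)) (bound := fun i => ‖d i‖)
    (f := fun T i => d i * ((T : ℂ)⁻¹ *
      ∫ s in (0 : ℝ)..T, Complex.exp (Complex.I * (φ i - φ j : ℝ) * s)))
    (g := fun i => if i = j then d j else 0) hd.norm ?_ ?_
  · rw [tsum_ite_eq] at hlim
    refine tendsto_nhds_unique hlim ?_
    have hz (T : ℝ) : ∑' i, d i * ((T : ℂ)⁻¹ *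
      ∫ s in (0 : ℝ)..T, Complex.exp (Complex.I * (φ i - φ j : ℝ) * s)) = 0 := by
      simp_rw [mul_left_comm (d _)]
      rw [tsum_mul_left, (hint T).tsum_eq, mul_zero]
    simp_rw [hz]
    exact tendsto_const_nhds
  · intro i
    by_cases hij : i = j
    · subst hij
      rw [if_pos rfl]
      refine tendsto_const_nhds.congr' ?_
      filter_upwards [eventually_gt_atTop 0] with T hT
      have : (T : ℂ) ≠ 0 := by exact_mod_cast hT.ne'
      simp [this]
    · rw [if_neg hij]
      have := (tendsto_average_exp (sub_ne_zero.mpr (hφ.ne hij))).const_mul (d i)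
      simpa using this
  · filter_upwards [eventually_gt_atTop 0] with T hT i
    rw [norm_mul, norm_mul, norm_inv, Complex.norm_real, Real.norm_of_nonneg hT.le]
    refine mul_le_of_le_one_right (norm_nonneg _) ?_
    rw [inv_mul_le_one₀ hT]
    have := intervalIntegral.norm_integral_le_of_norm_le_const (a := 0) (b := T) (C := 1)
      (f := fun s : ℝ => Complex.exp (Complex.I * (φ i - φ j : ℝ) * s))
      (fun s _ => (hnorm _ _).le)
    simpa [abs_of_pos hT] using this

end AlmostPeriodic

/-! ### Matrices acting on the half space, and fractional ideals -/

section Field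

variable {F : Type*} [Field F]

lemma moebius_mul (α β : GL (Fin 2) F) (τ : HalfSpace F) :
    moebius (α * β) τ = moebius α (moebius β τ) := by
  funext σ
  simp only [moebius, map_mul, mul_smul]

lemma TotPos.det_map_pos {β : GL (Fin 2) F} (hβ : TotPos β.1.det) (σ : F →+* ℝ) :
    0 < (Matrix.GeneralLinearGroup.map σ β).det.val := by
  have := hβ σ
  rw [RingHom.map_det] at this
  exact this

/-- The matrix `(1, b; 0, d)`. -/
def upperTri (b : F) (d : Fˣ) : GL (Fin 2) F :=
  Matrix.GeneralLinearGroup.mkOfDetNeZero !![1, b; 0, (d : F)] (by simp)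

lemma upperTri_val (b : F) (d : Fˣ) : (upperTri b d).1 = !![1, b; 0, (d : F)] := rfl

lemma det_upperTri (b : F) (d : Fˣ) : (upperTri b d).1.det = d := by
  simp [upperTri_val]

lemma mul_mem_of_le {A B C : FractionalIdeal (𝓞 F)⁰ F} {x y : F} (hx : x ∈ A) (hy : y ∈ B)
    (h : A * B ≤ C) : x * y ∈ C :=
  h (FractionalIdeal.mul_mem_mul hx hy)

lemma add_mem_fractionalIdeal {A : FractionalIdeal (𝓞 F)⁰ F} {x y : F} (hx : x ∈ A) (hy : y ∈ A) :
    x + y ∈ A := A.1.add_mem hx hy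

lemma sub_mem_fractionalIdeal {A : FractionalIdeal (𝓞 F)⁰ F} {x y : F} (hx : x ∈ A) (hy : y ∈ A) :
    x - y ∈ A := A.1.sub_mem hx hy

end Field

variable {F : Type*} [Field F] [NumberField F]

/-- Termwise integration of a series indexed by `F` requires a countable index set. -/
instance countable_numberField : Countable F :=
  (Module.finBasis ℚ F).equivFun.toEquiv.countable_iff.mpr inferInstance

/-! ### Real embeddings, the trace, and uniqueness of Fourier expansions -/

section TotallyReal

variable [IsTotallyReal F]

/-- The real embeddings of a totally real field are its complex embeddings. -/
noncomputable def realEmbeddingEquiv : (F →+* ℝ) ≃ (F →ₐ[ℚ] ℂ) :=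
  (Equiv.ofBijective (fun σ : F →+* ℝ => Complex.ofRealHom.comp σ) (by
    constructor
    · intro σ τ h
      ext x
      have := RingHom.congr_fun h x
      simpa using this
    · intro φ
      have hφ := IsTotallyReal.complexEmbedding_isReal φ
      exact ⟨hφ.embedding, by ext x; simp⟩)).trans (RingHom.equivRatAlgHom F ℂ)

lemma sum_realEmbedding_eq_trace (x : F) :
    ∑ σ : F →+* ℝ, σ x = (Algebra.trace ℚ F x : ℚ) := by
  have h := trace_eq_sum_embeddings (K := ℚ) (L := F) ℂ (x := x)
  rw [← Equiv.sum_comp (realEmbeddingEquiv (F := F))] at h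
  have h2 (σ : F →+* ℝ) : realEmbeddingEquiv σ x = ((σ x : ℝ) : ℂ) := rfl
  simp_rw [h2] at h
  rw [eq_ratCast] at h
  exact_mod_cast h.symm

instance nonempty_realEmbedding : Nonempty (F →+* ℝ) :=
  (realEmbeddingEquiv (F := F)).nonempty_congr.mpr ⟨(Classical.arbitrary (F →+* ℂ)).toRatAlgHom⟩

end TotallyReal

/-- Fourier expansions are unique. -/
lemma hasSum_expTrace_unique [IsTotallyReal F] {f : HalfSpace F → ℂ} {a b : F → ℂ}
    (ha : ∀ τ, HasSum (fun ξ : F => a ξ * expTrace ξ τ) (f τ))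
    (hb : ∀ τ, HasSum (fun ξ : F => b ξ * expTrace ξ τ) (f τ)) : a = b := by
  classical
  obtain ⟨σ₀⟩ := nonempty_realEmbedding (F := F)
  -- Moving a single coordinate horizontally suffices: the frequencies 2πσ₀(ξ) are already distinct,
  -- because σ₀ is injective.
  let τ (s : ℝ) : HalfSpace F := fun σ => if σ = σ₀ then s +ᵥ UpperHalfPlane.I else UpperHalfPlane.I
  have hτ (ξ : F) (s : ℝ) : expTrace ξ (τ s) =
      expTrace ξ (τ 0) * Complex.exp (Complex.I * (2 * Real.pi * σ₀ ξ : ℝ) * s) := by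
    have h1 (σ : F →+* ℝ) : ((τ s σ : ℍ) : ℂ) = (τ 0 σ : ℂ) + if σ = σ₀ then (s : ℂ) else 0 := by
      by_cases h : σ = σ₀
      · simp [τ, h, add_comm]
      · simp [τ, h]
    simp only [expTrace, ← Complex.exp_add, h1, mul_add, Finset.sum_add_distrib, mul_ite, mul_zero,
      Finset.sum_ite_eq', Finset.mem_univ, if_true]
    congr 1
    push_cast; ring
  funext ξ
  have hd (s : ℝ) : HasSum (fun ξ => ((a ξ - b ξ) * expTrace ξ (τ 0)) *
      Complex.exp (Complex.I * (2 * Real.pi * σ₀ ξ : ℝ) * s)) 0 := by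
    have := (ha (τ s)).sub (hb (τ s))
    rw [sub_self] at this
    refine this.congr_fun fun ξ => ?_
    rw [hτ ξ s]; ring
  have := eq_zero_of_hasSum_exp (φ := fun ξ : F => 2 * Real.pi * σ₀ ξ)
    (fun x y h => σ₀.injective (mul_left_cancel₀ (by positivity) h))
    (by simpa using (hd 0).summable) hd ξ
  rcases mul_eq_zero.mp this with h | h
  · exact sub_eq_zero.mp h
  · exact absurd h (Complex.exp_ne_zero _)

/-! ### The slash operator and its effect on Fourier series -/

section Slash

variable (k : (F →+* ℝ) → ℕ)

/-- The cocycle relation for the denominators. Positive determinants make the real powers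
multiplicative and the action genuinely fractional linear, without complex conjugation. -/
lemma slash_mul (f : HalfSpace F → ℂ) {α β : GL (Fin 2) F} (hα : TotPos α.1.det)
    (hβ : TotPos β.1.det) : slash k f (α * β) = slash k (slash k f α) β := by
  funext τ
  have hden (γ : GL (Fin 2) F) (τ : HalfSpace F) (σ : F →+* ℝ) :
      (σ (γ.1 1 0) : ℂ) * (τ σ : ℂ) + (σ (γ.1 1 1) : ℂ) =
        denom (Matrix.GeneralLinearGroup.map σ γ) (τ σ) := rfl
  have h1 (σ : F →+* ℝ) : denom (Matrix.GeneralLinearGroup.map σ (α * β)) (τ σ) =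
      denom (Matrix.GeneralLinearGroup.map σ α) (moebius β τ σ) *
        denom (Matrix.GeneralLinearGroup.map σ β) (τ σ) := by
    rw [map_mul, denom_cocycle _ _ (τ σ).im_ne_zero, moebius,
      coe_smul_of_det_pos (hβ.det_map_pos σ)]
  have h2 (σ : F →+* ℝ) : (σ (α * β).1.det) ^ ((k σ : ℝ) / 2) =
      (σ α.1.det) ^ ((k σ : ℝ) / 2) * (σ β.1.det) ^ ((k σ : ℝ) / 2) := by
    rw [Units.val_mul, Matrix.det_mul, map_mul, Real.mul_rpow (hα σ).le (hβ σ).le]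
  simp only [slash, hden, h1, h2, moebius_mul, mul_pow, Complex.ofReal_mul,
    Finset.prod_mul_distrib, mul_inv]
  ring

lemma slash_one (f : HalfSpace F → ℂ) : slash k f 1 = f := by
  funext τ
  have : moebius 1 τ = τ := by funext σ; simp [moebius]
  simp [slash, this]

lemma expTrace_moebius_upperTri (b : F) {d : Fˣ} (hd : TotPos (d : F)) (ξ : F) (τ : HalfSpace F) :
    expTrace ξ (moebius (upperTri b d) τ) =
      Complex.exp (2 * Real.pi * Complex.I * (∑ σ : F →+* ℝ, σ (d⁻¹ * ξ * b) : ℝ)) *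
        expTrace (d⁻¹ * ξ) τ := by
  have h (σ : F →+* ℝ) : (moebius (upperTri b d) τ σ : ℂ) = ((τ σ : ℂ) + σ b) / σ d := by
    rw [moebius, coe_smul_of_det_pos (TotPos.det_map_pos (by rwa [det_upperTri]) σ)]
    simp [num, denom, upperTri_val]
  simp only [expTrace, ← Complex.exp_add, h, ← mul_add, Complex.ofReal_sum,
    ← Finset.sum_add_distrib]
  congr 2
  refine Finset.sum_congr rfl fun σ _ => ?_
  have : (σ d : ℂ) ≠ 0 := by exact_mod_cast (hd σ).ne'
  simp only [Units.val_inv_eq_inv_val, map_mul, map_inv₀, Complex.ofReal_mul, Complex.ofReal_inv]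
  field_simp
  ring

/-- The matrix acts by τ ↦ (τ + b)/d, so the frequency ξ = dζ becomes ζ and picks up a character of
b; the weight factor is d^(k/2) d^(-k) = d^(-k/2). -/
lemma hasSum_slash_upperTri {f : HalfSpace F → ℂ} {a : F → ℂ}
    (ha : ∀ τ, HasSum (fun ξ : F => a ξ * expTrace ξ τ) (f τ)) (b : F) {d : Fˣ}
    (hd : TotPos (d : F)) (τ : HalfSpace F) :
    HasSum (fun ζ : F => ((∏ σ : F →+* ℝ, (((σ d) ^ (-(k σ : ℝ) / 2) : ℝ) : ℂ)) *
      Complex.exp (2 * Real.pi * Complex.I * (∑ σ : F →+* ℝ, σ (ζ * b) : ℝ)) * a (d * ζ)) *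
        expTrace ζ τ) (slash k f (upperTri b d) τ) := by
  have h1 := (ha (moebius (upperTri b d) τ)).mul_left
    (∏ σ : F →+* ℝ, (((σ d) ^ (-(k σ : ℝ) / 2) : ℝ) : ℂ))
  have h2 : slash k f (upperTri b d) τ =
      (∏ σ : F →+* ℝ, (((σ d) ^ (-(k σ : ℝ) / 2) : ℝ) : ℂ)) *
        f (moebius (upperTri b d) τ) := by
    rw [slash, det_upperTri, ← Finset.prod_inv_distrib, ← Finset.prod_mul_distrib]
    congr 1
    refine Finset.prod_congr rfl fun σ _ => ?_
    have hp := hd σ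
    have : (σ d) ^ (-(k σ : ℝ) / 2) = (σ d) ^ ((k σ : ℝ) / 2) * ((σ d) ^ (k σ))⁻¹ := by
      rw [← Real.rpow_natCast, ← Real.rpow_neg hp.le, ← Real.rpow_add hp]
      congr 1; ring
    rw [this]
    simp [upperTri_val]
  rw [← h2] at h1
  rw [← (Units.mulLeft d).hasSum_iff] at h1
  refine h1.congr_fun fun ζ => ?_
  simp only [Function.comp, Units.mulLeft_apply, expTrace_moebius_upperTri b hd,
    Units.val_inv_eq_inv_val, inv_mul_cancel_left₀ d.ne_zero]
  ring

end Slash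

/-! ### Fractional ideals and residues modulo a maximal ideal -/

section FractionalIdeals

lemma inv_mem_of_spanSingleton_eq {x : F} {A : FractionalIdeal (𝓞 F)⁰ F}
    (h : FractionalIdeal.spanSingleton (𝓞 F)⁰ x = A) : x⁻¹ ∈ A⁻¹ := by
  rw [← h, FractionalIdeal.spanSingleton_inv]
  exact FractionalIdeal.mem_spanSingleton_self _ _

lemma mem_of_spanSingleton_eq {x : F} {A : FractionalIdeal (𝓞 F)⁰ F}
    (h : FractionalIdeal.spanSingleton (𝓞 F)⁰ x = A) : x ∈ A :=
  h ▸ FractionalIdeal.mem_spanSingleton_self _ _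

lemma coeIdeal_mul_le (𝔞 : Ideal (𝓞 F)) (B : FractionalIdeal (𝓞 F)⁰ F) :
    (𝔞 : FractionalIdeal (𝓞 F)⁰ F) * B ≤ B := by
  simpa using mul_le_mul_left (FractionalIdeal.coeIdeal_le_one (S := (𝓞 F)⁰) (P := F) (I := 𝔞)) B

/-- The integral ideal `x B⁻¹` attached to an element `x` of a fractional ideal contained in
`𝔞 B`. -/
lemma exists_ideal_eq_spanSingleton_mul_inv {x : F} {𝔞 : Ideal (𝓞 F)}
    {B : FractionalIdeal (𝓞 F)⁰ F} (hB : B ≠ 0) (hx : x ∈ (𝔞 : FractionalIdeal (𝓞 F)⁰ F) * B) :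
    ∃ 𝔠 : Ideal (𝓞 F), 𝔠 ≤ 𝔞 ∧
      (𝔠 : FractionalIdeal (𝓞 F)⁰ F) = FractionalIdeal.spanSingleton (𝓞 F)⁰ x * B⁻¹ := by
  have h : FractionalIdeal.spanSingleton (𝓞 F)⁰ x * B⁻¹ ≤ 𝔞 := by
    have := mul_le_mul_left (FractionalIdeal.spanSingleton_le_iff_mem.mpr hx) B⁻¹
    rwa [mul_assoc, mul_inv_cancel₀ hB, mul_one] at this
  obtain ⟨𝔠, h𝔠⟩ := FractionalIdeal.le_one_iff_exists_coeIdeal.mp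
    (h.trans FractionalIdeal.coeIdeal_le_one)
  refine ⟨𝔠, ?_, h𝔠⟩
  rwa [← h𝔠, FractionalIdeal.coeIdeal_le_coeIdeal] at h

lemma mem_of_ideal_le {x : F} {𝔞 𝔠 : Ideal (𝓞 F)} {B : FractionalIdeal (𝓞 F)⁰ F} (hB : B ≠ 0)
    (h𝔠 : (𝔠 : FractionalIdeal (𝓞 F)⁰ F) = FractionalIdeal.spanSingleton (𝓞 F)⁰ x * B⁻¹)
    (h : 𝔠 ≤ 𝔞) : x ∈ (𝔞 : FractionalIdeal (𝓞 F)⁰ F) * B := by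
  rw [← FractionalIdeal.spanSingleton_le_iff_mem]
  have := mul_le_mul_left ((FractionalIdeal.coeIdeal_le_coeIdeal F).mpr h) B
  rwa [h𝔠, mul_assoc, inv_mul_cancel₀ hB, mul_one] at this

/-- Maximality gives 𝔠 + 𝔭 = 𝓞, and every element of 𝔠 is x times an element of B⁻¹. This inverts x
modulo 𝔭. -/
lemma exists_mul_sub_one_mem {𝔭 𝔠 : Ideal (𝓞 F)} (h𝔭 : 𝔭.IsMaximal) {x : F}
    {B : FractionalIdeal (𝓞 F)⁰ F}
    (h𝔠 : (𝔠 : FractionalIdeal (𝓞 F)⁰ F) = FractionalIdeal.spanSingleton (𝓞 F)⁰ x * B⁻¹)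
    (h : ¬ 𝔠 ≤ 𝔭) : ∃ y ∈ B⁻¹, 1 - x * y ∈ (𝔭 : FractionalIdeal (𝓞 F)⁰ F) := by
  have htop : 𝔠 ⊔ 𝔭 = ⊤ := by
    rw [sup_comm]
    exact h𝔭.1.2 _ (left_lt_sup.mpr h)
  obtain ⟨u, hu, v, hv, huv⟩ := Submodule.mem_sup.mp ((Ideal.eq_top_iff_one _).mp htop)
  have hu' : (u : F) ∈ (𝔠 : FractionalIdeal (𝓞 F)⁰ F) := FractionalIdeal.mem_coeIdeal_of_mem _ hu
  rw [h𝔠, FractionalIdeal.mem_singleton_mul] at hu'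
  obtain ⟨y, hy, huy⟩ := hu'
  refine ⟨y, hy, ?_⟩
  have : (1 : F) - x * y = (v : F) := by
    rw [← huy, sub_eq_iff_eq_add, add_comm, ← map_add, huv, map_one]
  rw [this]
  exact FractionalIdeal.mem_coeIdeal_of_mem _ hv

end FractionalIdeals

/-! ### Coset representatives for the Hecke operator at a prime -/

section Cosets

variable {T T' : (FractionalIdeal (𝓞 F)⁰ F)ˣ} {𝔫 𝔭 : Ideal (𝓞 F)}

/-- The last four hypotheses concern the entries of β · adj(β'): each lies in (det β') = 𝔭T'T⁻¹
times the ideal required of the corresponding entry in `Gamma T' 𝔫`. -/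
lemma mul_inv_mem_Gamma {β β' : GL (Fin 2) F} (h𝔭0 : 𝔭 ≠ ⊥)
    (hβ : TotPos β.1.det) (hβ' : TotPos β'.1.det)
    (hd : FractionalIdeal.spanSingleton (𝓞 F)⁰ β.1.det =
      (𝔭 : FractionalIdeal (𝓞 F)⁰ F) * (T' * T⁻¹ : (FractionalIdeal (𝓞 F)⁰ F)ˣ))
    (hd' : FractionalIdeal.spanSingleton (𝓞 F)⁰ β'.1.det =
      (𝔭 : FractionalIdeal (𝓞 F)⁰ F) * (T' * T⁻¹ : (FractionalIdeal (𝓞 F)⁰ F)ˣ))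
    (h00 : β.1 0 0 * β'.1 1 1 - β.1 0 1 * β'.1 1 0 ∈
      (𝔭 : FractionalIdeal (𝓞 F)⁰ F) * (T' * T⁻¹ : (FractionalIdeal (𝓞 F)⁰ F)ˣ))
    (h01 : β.1 0 1 * β'.1 0 0 - β.1 0 0 * β'.1 0 1 ∈
      (𝔭 : FractionalIdeal (𝓞 F)⁰ F) * (T * different F)⁻¹)
    (h10 : β.1 1 0 * β'.1 1 1 - β.1 1 1 * β'.1 1 0 ∈
      (𝔫 : FractionalIdeal (𝓞 F)⁰ F) * (T' * different F) *
        ((𝔭 : FractionalIdeal (𝓞 F)⁰ F) * (T' * T⁻¹ : (FractionalIdeal (𝓞 F)⁰ F)ˣ)))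
    (h11 : β.1 1 1 * β'.1 0 0 - β.1 1 0 * β'.1 0 1 ∈
      (𝔭 : FractionalIdeal (𝓞 F)⁰ F) * (T' * T⁻¹ : (FractionalIdeal (𝓞 F)⁰ F)ˣ)) :
    β * β'⁻¹ ∈ Gamma T' 𝔫 := by
  have hP : (𝔭 : FractionalIdeal (𝓞 F)⁰ F) ≠ 0 := FractionalIdeal.coeIdeal_ne_zero.mpr h𝔭0
  have hT := T.ne_zero
  have hT' := T'.ne_zero
  have hD := different_ne_zero (F := F)
  have hdet : (β'⁻¹).1.det = (β'.1.det)⁻¹ := by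
    rw [Matrix.coe_units_inv, Matrix.det_nonsing_inv, Ring.inverse_eq_inv']
  have hx : (β'⁻¹).1 = (β'.1.det)⁻¹ • β'.1.adjugate := by
    rw [Matrix.coe_units_inv, Matrix.inv_def, Ring.inverse_eq_inv']
  have hi := inv_mem_of_spanSingleton_eq hd'
  have hK : (𝔭 : FractionalIdeal (𝓞 F)⁰ F) *
      (T' * T⁻¹ : (FractionalIdeal (𝓞 F)⁰ F)ˣ) ≠ 0 := mul_ne_zero hP (Units.ne_zero _)
  refine ⟨?_, ?_, ?_, ?_, ?_, ?_⟩
  · rw [Units.val_mul, Matrix.det_mul, hdet]; exact hβ.mul hβ'.inv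
  · rw [Units.val_mul, Matrix.det_mul, hdet, ← FractionalIdeal.spanSingleton_mul_spanSingleton,
      ← FractionalIdeal.spanSingleton_inv, hd, hd', mul_inv_cancel₀ hK]
  · have := mul_mem_of_le h00 hi (mul_inv_cancel₀ hK).le
    convert this using 1
    rw [Units.val_mul, hx, Matrix.adjugate_fin_two]
    simp [Matrix.mul_apply, Fin.sum_univ_two]; ring
  · have := mul_mem_of_le h01 hi (C := ((T' : FractionalIdeal (𝓞 F)⁰ F) * different F)⁻¹)
      (le_of_eq (by push_cast; field_simp))
    convert this using 1
    rw [Units.val_mul, hx, Matrix.adjugate_fin_two]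
    simp [Matrix.mul_apply, Fin.sum_univ_two]; ring
  · have := mul_mem_of_le h10 hi 
      (C := (𝔫 : FractionalIdeal (𝓞 F)⁰ F) * ((T' : FractionalIdeal (𝓞 F)⁰ F) * different F))
      (by rw [mul_assoc, mul_inv_cancel₀ hK, mul_one])
    convert this using 1
    rw [Units.val_mul, hx, Matrix.adjugate_fin_two]
    simp [Matrix.mul_apply, Fin.sum_univ_two]; ring
  · have := mul_mem_of_le h11 hi (mul_inv_cancel₀ hK).le
    convert this using 1
    rw [Units.val_mul, hx, Matrix.adjugate_fin_two]
    simp [Matrix.mul_apply, Fin.sum_univ_two]; ring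

variable {t : NarrowClassGroup F → (FractionalIdeal (𝓞 F)⁰ F)ˣ} {ν μ : NarrowClassGroup F}

/-- The matrices in `heckeSet` whose first column is divisible by `𝔭`. -/
def heckeSetDiv (t : NarrowClassGroup F → (FractionalIdeal (𝓞 F)⁰ F)ˣ) (𝔫 𝔭 : Ideal (𝓞 F))
    (ν μ : NarrowClassGroup F) : Set (GL (Fin 2) F) :=
  {β | β ∈ heckeSet t 𝔫 𝔭 ν μ ∧ β.1 0 0 ∈ (𝔭 : FractionalIdeal (𝓞 F)⁰ F) ∧
    β.1 1 0 ∈ (𝔭 : FractionalIdeal (𝓞 F)⁰ F) *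
      ((𝔫 : FractionalIdeal (𝓞 F)⁰ F) * (t μ * different F))}

/-- Every product in an entry of β · adj(β') has one factor from a first column, which supplies the
needed 𝔭. So these matrices form at most one coset. -/
lemma mul_inv_mem_Gamma_of_mem_heckeSetDiv (h𝔭0 : 𝔭 ≠ ⊥) {β β' : GL (Fin 2) F}
    (hβ : β ∈ heckeSetDiv t 𝔫 𝔭 ν μ) (hβ' : β' ∈ heckeSetDiv t 𝔫 𝔭 ν μ) :
    β * β'⁻¹ ∈ Gamma (t μ) 𝔫 := by
  obtain ⟨⟨h1, h2, -, h4, -, h6⟩, ha, hc⟩ := hβ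
  obtain ⟨⟨k1, k2, -, k4, -, k6⟩, ka, kc⟩ := hβ'
  have hD := different_ne_zero (F := F)
  have hT := (t ν).ne_zero
  have hT' := (t μ).ne_zero
  have e1 : (𝔭 : FractionalIdeal (𝓞 F)⁰ F) *
        ((𝔫 : FractionalIdeal (𝓞 F)⁰ F) * (t μ * different F)) *
        ((t ν : FractionalIdeal (𝓞 F)⁰ F) * different F)⁻¹ ≤
      (𝔭 : FractionalIdeal (𝓞 F)⁰ F) * (t μ * (t ν)⁻¹ : (FractionalIdeal (𝓞 F)⁰ F)ˣ) := by
    refine le_of_eq_of_le ?_ (coeIdeal_mul_le 𝔫 _)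
    push_cast; field_simp
  have e2 : (𝔭 : FractionalIdeal (𝓞 F)⁰ F) *
        ((𝔫 : FractionalIdeal (𝓞 F)⁰ F) * (t μ * different F)) *
        (t μ * (t ν)⁻¹ : (FractionalIdeal (𝓞 F)⁰ F)ˣ) ≤
      (𝔫 : FractionalIdeal (𝓞 F)⁰ F) * (t μ * different F) *
        ((𝔭 : FractionalIdeal (𝓞 F)⁰ F) * (t μ * (t ν)⁻¹ : (FractionalIdeal (𝓞 F)⁰ F)ˣ)) :=
    le_of_eq (by ring)
  refine mul_inv_mem_Gamma (T := t ν) h𝔭0 h1 k1 h2 k2 ?_ ?_ ?_ ?_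
  · refine sub_mem_fractionalIdeal (mul_mem_of_le ha k6 le_rfl) ?_
    rw [mul_comm (β.1 0 1)]
    exact mul_mem_of_le kc h4 e1
  · rw [mul_comm (β.1 0 1)]
    exact sub_mem_fractionalIdeal (mul_mem_of_le ka h4 le_rfl) (mul_mem_of_le ha k4 le_rfl)
  · rw [mul_comm (β.1 1 1)]
    exact sub_mem_fractionalIdeal (mul_mem_of_le hc k6 e2) (mul_mem_of_le kc h6 e2)
  · rw [mul_comm (β.1 1 1)]
    exact sub_mem_fractionalIdeal (mul_mem_of_le ka h6 le_rfl) (mul_mem_of_le hc k4 e1)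

lemma exists_mem_heckeSetDiv (h𝔫 : 𝔫 ≠ ⊥) (h𝔭 : 𝔭.IsMaximal) (h𝔭0 : 𝔭 ≠ ⊥) (h𝔭𝔫 : ¬ 𝔭 ∣ 𝔫)
    {δ : F} (hδ : TotPos δ) (hδ0 : δ ≠ 0)
    (hd : FractionalIdeal.spanSingleton (𝓞 F)⁰ δ =
      (𝔭 : FractionalIdeal (𝓞 F)⁰ F) * (t μ * (t ν)⁻¹ : (FractionalIdeal (𝓞 F)⁰ F)ˣ)) :
    (heckeSetDiv t 𝔫 𝔭 ν μ).Nonempty := by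
  have hD := different_ne_zero (F := F)
  have hT := (t ν).ne_zero
  have hT' := (t μ).ne_zero
  have hP : (𝔭 : FractionalIdeal (𝓞 F)⁰ F) ≠ 0 := FractionalIdeal.coeIdeal_ne_zero.mpr h𝔭0
  have hN : (𝔫 : FractionalIdeal (𝓞 F)⁰ F) ≠ 0 := FractionalIdeal.coeIdeal_ne_zero.mpr h𝔫
  have hB : (t μ : FractionalIdeal (𝓞 F)⁰ F) * different F ≠ 0 := mul_ne_zero hT' hD
  obtain ⟨c, hc, hc0⟩ : ∃ c ∈ (𝔭 : FractionalIdeal (𝓞 F)⁰ F) *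
      ((𝔫 : FractionalIdeal (𝓞 F)⁰ F) * (t μ * different F)), c ≠ 0 := by
    by_contra! h
    exact mul_ne_zero hP (mul_ne_zero hN hB) (FractionalIdeal.eq_zero_iff.mpr h)
  obtain ⟨𝔠, h𝔠, h𝔠c⟩ := exists_ideal_eq_spanSingleton_mul_inv (𝔞 := 𝔭 * 𝔫) hB
    (by rwa [FractionalIdeal.coeIdeal_mul, mul_assoc])
  have h𝔠0 : 𝔠 ≠ 0 := by
    rintro rfl
    refine mul_ne_zero (FractionalIdeal.spanSingleton_ne_zero_iff.mpr hc0) (inv_ne_zero hB) ?_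
    rw [← h𝔠c]; simp
  -- Choose a with c(t_μ𝔇)⁻¹ + (a) = 𝔭. After multiplication by t_μt_ν⁻¹ this writes δ as bc + ad
  -- with b and d in the required ideals.
  obtain ⟨a, ha⟩ := IsDedekindDomain.exists_sup_span_eq (h𝔠.trans Ideal.mul_le_left) h𝔠0
  have hδm := mem_of_spanSingleton_eq hd
  have hK : (𝔭 : FractionalIdeal (𝓞 F)⁰ F) * (t μ * (t ν)⁻¹ : (FractionalIdeal (𝓞 F)⁰ F)ˣ) =
      FractionalIdeal.spanSingleton (𝓞 F)⁰ c * ((t ν : FractionalIdeal (𝓞 F)⁰ F) * different F)⁻¹ +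
      FractionalIdeal.spanSingleton (𝓞 F)⁰ (a : F) *
        (t μ * (t ν)⁻¹ : (FractionalIdeal (𝓞 F)⁰ F)ˣ) := by
    rw [← ha, FractionalIdeal.coeIdeal_sup, add_mul, h𝔠c, FractionalIdeal.coeIdeal_span_singleton]
    congr 1
    push_cast; field_simp
  rw [hK, FractionalIdeal.mem_add] at hδm
  obtain ⟨u, hu, v, hv, huv⟩ := hδm
  obtain ⟨b, hb, rfl⟩ := FractionalIdeal.mem_singleton_mul.mp hu
  obtain ⟨d, hd', rfl⟩ := FractionalIdeal.mem_singleton_mul.mp hv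
  have hdet : (!![(a : F), -b; c, d]).det = δ := by
    rw [Matrix.det_fin_two_of, ← huv]; ring
  refine ⟨Matrix.GeneralLinearGroup.mkOfDetNeZero !![(a : F), -b; c, d] (by rwa [hdet]),
    ⟨?_, ?_, ⟨a, rfl, ?_⟩, ?_, ?_, hd'⟩, ?_, hc⟩
  · change TotPos (!![(a : F), -b; c, d]).det
    rwa [hdet]
  · change FractionalIdeal.spanSingleton (𝓞 F)⁰ (!![(a : F), -b; c, d]).det = _
    rwa [hdet]
  · have hle : 𝔭 ⊔ 𝔫 ≤ Ideal.span {a} ⊔ 𝔫 := by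
      rw [← ha]
      refine sup_le (sup_le ?_ le_sup_left) le_sup_right
      exact (h𝔠.trans Ideal.mul_le_right).trans le_sup_right
    refine top_le_iff.mp (le_trans (top_le_iff.mpr ?_) hle)
    exact h𝔭.1.2 _ (left_lt_sup.mpr fun h => h𝔭𝔫 (Ideal.dvd_iff_le.mpr h))
  · exact (((t ν : FractionalIdeal (𝓞 F)⁰ F) * different F)⁻¹).1.neg_mem hb
  · exact coeIdeal_mul_le 𝔭 _ hc
  · refine FractionalIdeal.mem_coeIdeal_of_mem _ ?_
    rw [← ha]
    exact Ideal.mem_sup_right (Ideal.mem_span_singleton_self a)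

/-- A matrix in `heckeSet` whose first column is not divisible by `𝔭` is equivalent to an upper
triangular one. -/
lemma exists_mul_inv_upperTri_mem_Gamma (h𝔭 : 𝔭.IsMaximal) (h𝔭0 : 𝔭 ≠ ⊥) (h𝔭𝔫 : ¬ 𝔭 ∣ 𝔫)
    {δ : Fˣ} (hδ : TotPos (δ : F))
    (hd : FractionalIdeal.spanSingleton (𝓞 F)⁰ (δ : F) =
      (𝔭 : FractionalIdeal (𝓞 F)⁰ F) * (t μ * (t ν)⁻¹ : (FractionalIdeal (𝓞 F)⁰ F)ˣ))
    {β : GL (Fin 2) F} (hβ : β ∈ heckeSet t 𝔫 𝔭 ν μ) (hβ' : β ∉ heckeSetDiv t 𝔫 𝔭 ν μ) :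
    ∃ b ∈ ((t ν : FractionalIdeal (𝓞 F)⁰ F) * different F)⁻¹,
      ∀ b', b - b' ∈ (𝔭 : FractionalIdeal (𝓞 F)⁰ F) *
        ((t ν : FractionalIdeal (𝓞 F)⁰ F) * different F)⁻¹ →
        β * (upperTri b' δ)⁻¹ ∈ Gamma (t μ) 𝔫 := by
  have hβ0 := hβ
  obtain ⟨h1, h2, ⟨a, h3, h3'⟩, h4, h5, h6⟩ := hβ
  have hD := different_ne_zero (F := F)
  have hT := (t ν).ne_zero
  have hT' := (t μ).ne_zero
  have hB : (t μ : FractionalIdeal (𝓞 F)⁰ F) * different F ≠ 0 := mul_ne_zero hT' hD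
  have h00 : β.1 0 0 ∈ (1 : FractionalIdeal (𝓞 F)⁰ F) := by
    rw [h3]; exact (FractionalIdeal.mem_one_iff _).mpr ⟨a, rfl⟩
  -- The row (x, y) is a left inverse of the first column modulo 𝔭. If the upper entry lies in 𝔭,
  -- the lower one must be a unit there: otherwise coprimality of 𝔭 and 𝔫 would put β in
  -- `heckeSetDiv`.
  obtain ⟨x, hx, y, hy, hxy⟩ : ∃ x ∈ (1 : FractionalIdeal (𝓞 F)⁰ F),
      ∃ y ∈ ((t μ : FractionalIdeal (𝓞 F)⁰ F) * different F)⁻¹,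
        1 - β.1 0 0 * x - β.1 1 0 * y ∈ (𝔭 : FractionalIdeal (𝓞 F)⁰ F) := by
    by_cases ha : β.1 0 0 ∈ (𝔭 : FractionalIdeal (𝓞 F)⁰ F)
    · obtain ⟨𝔠, h𝔠, h𝔠c⟩ := exists_ideal_eq_spanSingleton_mul_inv hB h5
      have hnot : ¬ 𝔠 ≤ 𝔭 := fun h => by
        refine hβ' ⟨hβ0, ha, ?_⟩
        have hcop : IsCoprime 𝔭 𝔫 := Ideal.isCoprime_iff_sup_eq.mpr
          (h𝔭.1.2 _ (left_lt_sup.mpr fun h => h𝔭𝔫 (Ideal.dvd_iff_le.mpr h)))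
        have hle : 𝔠 ≤ 𝔭 * 𝔫 := Ideal.dvd_iff_le.mp
          (hcop.mul_dvd (Ideal.dvd_iff_le.mpr h) (Ideal.dvd_iff_le.mpr h𝔠))
        have := mem_of_ideal_le hB h𝔠c hle
        rwa [FractionalIdeal.coeIdeal_mul, mul_assoc] at this
      obtain ⟨y, hy, hxy⟩ := exists_mul_sub_one_mem h𝔭 h𝔠c hnot
      exact ⟨0, FractionalIdeal.zero_mem _, y, hy, by simpa using hxy⟩
    · obtain ⟨𝔠, h𝔠, h𝔠c⟩ := exists_ideal_eq_spanSingleton_mul_inv (𝔞 := ⊤) (x := β.1 0 0)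
        (B := 1) one_ne_zero (by simpa using h00)
      have hnot : ¬ 𝔠 ≤ 𝔭 := fun h => ha (by
        simpa using mem_of_ideal_le (one_ne_zero (α := FractionalIdeal (𝓞 F)⁰ F)) h𝔠c h)
      obtain ⟨x, hx, hxy⟩ := exists_mul_sub_one_mem h𝔭 h𝔠c hnot
      exact ⟨x, by simpa using hx, 0, FractionalIdeal.zero_mem _, by simpa using hxy⟩
  have hdet : β.1.det ∈ (𝔭 : FractionalIdeal (𝓞 F)⁰ F) *
      (t μ * (t ν)⁻¹ : (FractionalIdeal (𝓞 F)⁰ F)ˣ) := mem_of_spanSingleton_eq h2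
  rw [Matrix.det_fin_two] at hdet
  have e1 : ((t μ : FractionalIdeal (𝓞 F)⁰ F) * different F)⁻¹ *
      (t μ * (t ν)⁻¹ : (FractionalIdeal (𝓞 F)⁰ F)ˣ) =
        ((t ν : FractionalIdeal (𝓞 F)⁰ F) * different F)⁻¹ := by
    push_cast; field_simp
  have e2 : (𝔫 : FractionalIdeal (𝓞 F)⁰ F) * (t μ * different F) *
      ((𝔭 : FractionalIdeal (𝓞 F)⁰ F) * ((t ν : FractionalIdeal (𝓞 F)⁰ F) * different F)⁻¹) ≤
      (𝔭 : FractionalIdeal (𝓞 F)⁰ F) * (t μ * (t ν)⁻¹ : (FractionalIdeal (𝓞 F)⁰ F)ˣ) := by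
    refine le_of_eq_of_le ?_ (coeIdeal_mul_le 𝔫 _)
    push_cast; field_simp
  -- If β = γ(1, b; 0, δ) with γ in the group, pairing (x, y) with the second column recovers b
  -- modulo 𝔭(t_ν𝔇)⁻¹; hence this choice.
  refine ⟨x * β.1 0 1 + y * β.1 1 1, add_mem_fractionalIdeal
    (mul_mem_of_le hx h4 (one_mul _).le) (mul_mem_of_le hy h6 e1.le), fun b' hb' => ?_⟩
  refine mul_inv_mem_Gamma (T := t ν) h𝔭0 h1 (by rwa [det_upperTri]) h2 (by rwa [det_upperTri])
    ?_ ?_ ?_ ?_ <;> simp only [upperTri_val, Matrix.of_apply, Matrix.cons_val', Matrix.cons_val_zero,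
      Matrix.cons_val_one, Matrix.cons_val_fin_one, mul_zero, sub_zero, mul_one]
  · exact mul_mem_of_le h00 (mem_of_spanSingleton_eq hd) (one_mul _).le
  · have := add_mem_fractionalIdeal (sub_mem_fractionalIdeal
      (mul_mem_of_le hxy h4 le_rfl) (mul_mem_of_le hy hdet
        (C := (𝔭 : FractionalIdeal (𝓞 F)⁰ F) * ((t ν : FractionalIdeal (𝓞 F)⁰ F) * different F)⁻¹)
        (le_of_eq (by rw [← e1]; ring)))) (mul_mem_of_le h00 hb' (one_mul _).le)
    convert this using 1
    ring
  · exact mul_mem_of_le h5 (mem_of_spanSingleton_eq hd) le_rfl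
  · have := add_mem_fractionalIdeal (add_mem_fractionalIdeal
      (mul_mem_of_le hxy h6 le_rfl) (mul_mem_of_le hx hdet (one_mul _).le))
        (mul_mem_of_le h5 hb' e2)
    convert this using 1
    ring

lemma upperTri_mem_heckeSet {δ : Fˣ} (hδ : TotPos (δ : F))
    (hd : FractionalIdeal.spanSingleton (𝓞 F)⁰ (δ : F) =
      (𝔭 : FractionalIdeal (𝓞 F)⁰ F) * (t μ * (t ν)⁻¹ : (FractionalIdeal (𝓞 F)⁰ F)ˣ)) {b : F}
    (hb : b ∈ ((t ν : FractionalIdeal (𝓞 F)⁰ F) * different F)⁻¹) :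
    upperTri b δ ∈ heckeSet t 𝔫 𝔭 ν μ := by
  refine ⟨by rwa [det_upperTri], by rwa [det_upperTri], ⟨1, by simp [upperTri_val], by simp⟩,
    by simpa [upperTri_val] using hb, ?_, ?_⟩
  · simpa [upperTri_val] using FractionalIdeal.zero_mem _
  · have := coeIdeal_mul_le 𝔭 _ (mem_of_spanSingleton_eq hd)
    simpa [upperTri_val] using this

/-- The upper right entry of the quotient is (b - b')/δ. Hence distinct residues b give distinct
cosets. -/
lemma sub_mem_of_upperTri_mul_inv_mem_Gamma {δ : Fˣ}
    (hd : FractionalIdeal.spanSingleton (𝓞 F)⁰ (δ : F) =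
      (𝔭 : FractionalIdeal (𝓞 F)⁰ F) * (t μ * (t ν)⁻¹ : (FractionalIdeal (𝓞 F)⁰ F)ˣ)) {b b' : F}
    (h : upperTri b δ * (upperTri b' δ)⁻¹ ∈ Gamma (t μ) 𝔫) :
    b - b' ∈ (𝔭 : FractionalIdeal (𝓞 F)⁰ F) *
      ((t ν : FractionalIdeal (𝓞 F)⁰ F) * different F)⁻¹ := by
  have h01 := h.2.2.2.1
  have hx : ((upperTri b' δ)⁻¹).1 = (δ : F)⁻¹ • (upperTri b' δ).1.adjugate := by
    rw [Matrix.coe_units_inv, Matrix.inv_def, Ring.inverse_eq_inv', det_upperTri]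
  rw [Units.val_mul, hx, upperTri_val, upperTri_val, Matrix.adjugate_fin_two] at h01
  have hT := (t ν).ne_zero
  have hT' := (t μ).ne_zero
  have := mul_mem_of_le h01 (mem_of_spanSingleton_eq hd)
    (C := (𝔭 : FractionalIdeal (𝓞 F)⁰ F) * ((t ν : FractionalIdeal (𝓞 F)⁰ F) * different F)⁻¹)
    (le_of_eq (by push_cast; have := different_ne_zero (F := F); field_simp))
  convert this using 1
  simp [Matrix.mul_apply, Fin.sum_univ_two]
  field_simp
  ring

/-- Left multiplication by the group preserves divisibility of the first column by 𝔭, whereas the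
first column here contains 1. -/
lemma not_mem_heckeSetDiv_of_mul_mem (h𝔭 : 𝔭.IsMaximal) {b : F} {δ : Fˣ}
    {γ : GL (Fin 2) F} (hγ : γ ∈ heckeSetDiv t 𝔫 𝔭 ν μ) :
    upperTri b δ * γ⁻¹ ∉ Gamma (t μ) 𝔫 := by
  intro h
  obtain ⟨-, -, h3, h4, -⟩ := h
  have e : (upperTri b δ).1 = (upperTri b δ * γ⁻¹).1 * γ.1 := by
    rw [← Units.val_mul, inv_mul_cancel_right]
  have e00 := congrFun (congrFun e 0) 0
  rw [Matrix.mul_apply, Fin.sum_univ_two] at e00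
  have hB : (t μ : FractionalIdeal (𝓞 F)⁰ F) * different F ≠ 0 :=
    mul_ne_zero (t μ).ne_zero different_ne_zero
  have h1 : (1 : F) ∈ (𝔭 : FractionalIdeal (𝓞 F)⁰ F) := by
    have : (upperTri b δ).1 0 0 = 1 := by simp [upperTri_val]
    rw [← this, e00]
    refine add_mem_fractionalIdeal (mul_mem_of_le h3 hγ.2.1 (one_mul _).le)
      (mul_mem_of_le h4 hγ.2.2 (le_of_eq_of_le ?_ (coeIdeal_mul_le 𝔫 _)))
    rw [mul_left_comm, mul_left_comm _ (𝔫 : FractionalIdeal (𝓞 F)⁰ F), inv_mul_cancel₀ hB, mul_one,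
      mul_comm]
  obtain ⟨x, hx, hx1⟩ := (FractionalIdeal.mem_coeIdeal _).mp h1
  have : x = 1 := RingOfIntegers.ext (by simpa using hx1)
  exact h𝔭.ne_top ((Ideal.eq_top_iff_one _).mpr (this ▸ hx))

end Cosets

/-! ### Representatives of narrow ideal classes -/

section Representatives

variable {t : NarrowClassGroup F → (FractionalIdeal (𝓞 F)⁰ F)ˣ}

lemma IsRepresentatives.exists_eq_mul (ht : IsRepresentatives t)
    (𝔟 : (FractionalIdeal (𝓞 F)⁰ F)ˣ) : ∃ (ν : NarrowClassGroup F) (x : Fˣ), TotPos (x : F) ∧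
      (𝔟 : FractionalIdeal (𝓞 F)⁰ F) = FractionalIdeal.spanSingleton (𝓞 F)⁰ (x : F) * t ν := by
  obtain ⟨x, hx, hxb⟩ := QuotientGroup.eq.mp (ht (QuotientGroup.mk 𝔟))
  refine ⟨QuotientGroup.mk 𝔟, x, hx, ?_⟩
  have := congrArg Units.val (eq_inv_mul_iff_mul_eq.mp hxb)
  rw [Units.val_mul, coe_toPrincipalIdeal] at this
  rw [← this, mul_comm]

lemma IsRepresentatives.eq_of_eq_mul (ht : IsRepresentatives t) {ν μ : NarrowClassGroup F} {x : Fˣ}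
    (hx : TotPos (x : F))
    (h : (t μ : FractionalIdeal (𝓞 F)⁰ F) =
      FractionalIdeal.spanSingleton (𝓞 F)⁰ (x : F) * t ν) : μ = ν := by
  rw [← ht μ, ← ht ν, eq_comm, QuotientGroup.eq]
  refine ⟨x, hx, ?_⟩
  rw [eq_inv_mul_iff_mul_eq]
  ext1
  rw [Units.val_mul, coe_toPrincipalIdeal, h, mul_comm]

end Representatives

/-! ### Trace duality and the different -/

section Trace

/-- The dual of I is I⁻¹𝔇⁻¹. Thus the lattice of translations in the group is exactly dual to the
lattice of frequencies. -/
lemma dual_inv_mul_different (T : (FractionalIdeal (𝓞 F)⁰ F)ˣ) :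
    FractionalIdeal.dual ℤ ℚ ((T : FractionalIdeal (𝓞 F)⁰ F) * different F)⁻¹ = T := by
  have hD : FractionalIdeal.dual ℤ ℚ (1 : FractionalIdeal (𝓞 F)⁰ F) = (different F)⁻¹ := by
    rw [different, coeIdeal_differentIdeal ℤ ℚ F (𝓞 F), inv_inv]
  rw [FractionalIdeal.dual_eq_mul_inv, hD, inv_inv, mul_left_comm,
    inv_mul_cancel₀ different_ne_zero, mul_one]

variable [IsTotallyReal F]

lemma mem_of_exp_trace_eq_one {T : (FractionalIdeal (𝓞 F)⁰ F)ˣ} {ξ : F}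
    (h : ∀ b ∈ ((T : FractionalIdeal (𝓞 F)⁰ F) * different F)⁻¹,
      Complex.exp (2 * Real.pi * Complex.I * (∑ σ : F →+* ℝ, σ (ξ * b) : ℝ)) = 1) :
    ξ ∈ (T : FractionalIdeal (𝓞 F)⁰ F) := by
  have hJ : ((T : FractionalIdeal (𝓞 F)⁰ F) * different F)⁻¹ ≠ 0 :=
    inv_ne_zero (mul_ne_zero T.ne_zero different_ne_zero)
  rw [← dual_inv_mul_different T, FractionalIdeal.mem_dual hJ]
  intro b hb
  have := h b hb
  rw [sum_realEmbedding_eq_trace, Complex.exp_eq_one_iff] at this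
  obtain ⟨n, hn⟩ := this
  refine ⟨n, ?_⟩
  rw [mul_comm (n : ℂ)] at hn
  have := mul_left_cancel₀ Complex.two_pi_I_ne_zero hn
  rw [Algebra.traceForm_apply]
  simp only [eq_intCast]
  exact_mod_cast this.symm

lemma exp_trace_eq_one {T : (FractionalIdeal (𝓞 F)⁰ F)ˣ} {ξ b : F}
    (hξ : ξ ∈ (T : FractionalIdeal (𝓞 F)⁰ F))
    (hb : b ∈ ((T : FractionalIdeal (𝓞 F)⁰ F) * different F)⁻¹) :
    Complex.exp (2 * Real.pi * Complex.I * (∑ σ : F →+* ℝ, σ (ξ * b) : ℝ)) = 1 := by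
  have hJ : ((T : FractionalIdeal (𝓞 F)⁰ F) * different F)⁻¹ ≠ 0 :=
    inv_ne_zero (mul_ne_zero T.ne_zero different_ne_zero)
  rw [← dual_inv_mul_different T, FractionalIdeal.mem_dual hJ] at hξ
  obtain ⟨n, hn⟩ := hξ b hb
  rw [Algebra.traceForm_apply, eq_intCast] at hn
  rw [sum_realEmbedding_eq_trace, Complex.exp_eq_one_iff, ← hn]
  exact ⟨n, by push_cast; ring⟩

end Trace

/-! ### Existence and support of Fourier expansions -/

section FourierCoefficients

variable {k : (F →+* ℝ) → ℕ} {𝔫 : Ideal (𝓞 F)} {T : (FractionalIdeal (𝓞 F)⁰ F)ˣ}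
  {f : HalfSpace F → ℂ}

/-- The cusp condition at α = 1 supplies an expansion, so `fourierCoeff` does not take its default
value 0. -/
lemma IsModularForm.hasSum_fourierCoeff {Γ : Subgroup (GL (Fin 2) F)} (hf : IsModularForm k Γ f)
    (τ : HalfSpace F) : HasSum (fun ξ : F => fourierCoeff f ξ * expTrace ξ τ) (f τ) := by
  obtain ⟨a, ha, -⟩ := hf.holo_cusps 1 (fun σ => by simp)
  rw [slash_one] at ha
  have h : ∃ a, HasFourierExpansion f a := ⟨a, ha⟩
  simp only [fourierCoeff, dif_pos h]
  exact h.choose_spec.2 τ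

/-- Invariance under τ ↦ τ + b forces exp(2πi Tr(ξb)) = 1 for all b in (T𝔇)⁻¹ at any frequency that
occurs. -/
lemma IsModularForm.mem_of_fourierCoeff_ne_zero [IsTotallyReal F]
    (hf : IsModularForm k (Gamma T 𝔫) f) {ξ : F} (hξ : fourierCoeff f ξ ≠ 0) :
    ξ ∈ (T : FractionalIdeal (𝓞 F)⁰ F) := by
  refine mem_of_exp_trace_eq_one fun b hb => ?_
  have hone : TotPos ((1 : Fˣ) : F) := fun σ => by simp
  have hmem : upperTri b 1 ∈ Gamma T 𝔫 := by
    refine ⟨by rwa [det_upperTri], by simp [det_upperTri], ?_, ?_, ?_, ?_⟩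
    · simp [upperTri_val]
    · simpa [upperTri_val] using hb
    · simpa [upperTri_val] using FractionalIdeal.zero_mem _
    · simp [upperTri_val]
  have h := fun τ => hasSum_slash_upperTri k hf.hasSum_fourierCoeff b hone τ
  rw [hf.slash_eq _ hmem] at h
  have := congrFun (hasSum_expTrace_unique h hf.hasSum_fourierCoeff) ξ
  simp only [Units.val_one, map_one, Real.one_rpow, Complex.ofReal_one, Finset.prod_const_one,
    one_mul] at this
  exact mul_right_cancel₀ hξ (this.trans (one_mul _).symm)

end FourierCoefficients

/-! ### Evaluation of the Hecke operator -/

section HeckeOperator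

variable {t : NarrowClassGroup F → (FractionalIdeal (𝓞 F)⁰ F)ˣ} {k : (F →+* ℝ) → ℕ}
  {𝔫 𝔭 : Ideal (𝓞 F)} {f : Family F} {ν μ μ' : NarrowClassGroup F}

lemma slash_eq_of_mul_inv_mem {f : HalfSpace F → ℂ} {Γ : Subgroup (GL (Fin 2) F)}
    (hf : ∀ γ ∈ Γ, slash k f γ = f) (hΓ : ∀ γ ∈ Γ, TotPos γ.1.det) {α β : GL (Fin 2) F}
    (hβ : TotPos β.1.det) (h : α * β⁻¹ ∈ Γ) : slash k f α = slash k f β := by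
  rw [← inv_mul_cancel_right α β, slash_mul k f (hΓ _ h) hβ, hf _ h]

/-- With both entries of the first column divisible by 𝔭, β · diag(1, ε)⁻¹ lies in `centralSet` for
𝔷 = 𝔭, so slashing by it carries f_μ to f_μ'. -/
lemma slash_eq_of_mem_heckeSetDiv (h𝔭0 : 𝔭 ≠ ⊥) (hf : HasTrivialCharacter t k 𝔫 f) {ε : Fˣ}
    (hε : TotPos (ε : F))
    (he : (𝔭 : FractionalIdeal (𝓞 F)⁰ F) * FractionalIdeal.spanSingleton (𝓞 F)⁰ (ε : F) =
      (t μ' * (t ν)⁻¹ : (FractionalIdeal (𝓞 F)⁰ F)ˣ)) {β : GL (Fin 2) F}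
    (hβ : β ∈ heckeSetDiv t 𝔫 𝔭 ν μ) : slash k (f μ) β = slash k (f μ') (upperTri 0 ε) := by
  obtain ⟨⟨h1, h2, -, h4, -, h6⟩, ha, hc⟩ := hβ
  have hP : (𝔭 : FractionalIdeal (𝓞 F)⁰ F) ≠ 0 := FractionalIdeal.coeIdeal_ne_zero.mpr h𝔭0
  have hT := (t ν).ne_zero
  have hT' := (t μ).ne_zero
  have hT'' := (t μ').ne_zero
  have hD := different_ne_zero (F := F)
  have hεi : (ε : F)⁻¹ ∈ (𝔭 : FractionalIdeal (𝓞 F)⁰ F) *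
      ((t ν * (t μ')⁻¹ : (FractionalIdeal (𝓞 F)⁰ F)ˣ)) := by
    have h := inv_mem_of_spanSingleton_eq (rfl : FractionalIdeal.spanSingleton (𝓞 F)⁰ (ε : F) = _)
    have hs : FractionalIdeal.spanSingleton (𝓞 F)⁰ (ε : F) =
        (𝔭 : FractionalIdeal (𝓞 F)⁰ F)⁻¹ * (t μ' * (t ν)⁻¹ : (FractionalIdeal (𝓞 F)⁰ F)ˣ) := by
      rw [← he, inv_mul_cancel_left₀ hP]
    rw [hs] at h
    convert h using 1
    push_cast; field_simp
  have hinv : ((upperTri 0 ε)⁻¹).1 = !![1, 0; 0, (ε : F)⁻¹] := by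
    rw [Matrix.coe_units_inv, Matrix.inv_def, Ring.inverse_eq_inv', det_upperTri, upperTri_val,
      Matrix.adjugate_fin_two]
    ext i j
    fin_cases i <;> fin_cases j <;> simp
  have hval : (β * (upperTri 0 ε)⁻¹).1 =
      !![β.1 0 0, β.1 0 1 * (ε : F)⁻¹; β.1 1 0, β.1 1 1 * (ε : F)⁻¹] := by
    rw [Units.val_mul, hinv]
    ext i j
    fin_cases i <;> fin_cases j <;> simp [Matrix.mul_apply, Fin.sum_univ_two]
  have hdet : (β * (upperTri 0 ε)⁻¹).1.det = β.1.det * (ε : F)⁻¹ := by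
    rw [hval, Matrix.det_fin_two_of, Matrix.det_fin_two]; ring
  have hpos : TotPos (β * (upperTri 0 ε)⁻¹).1.det := by rw [hdet]; exact h1.mul hε.inv
  have hmem : β * (upperTri 0 ε)⁻¹ ∈
      centralSet t 𝔫 (Units.mk0 (𝔭 : FractionalIdeal (𝓞 F)⁰ F) hP) μ' μ := by
    refine ⟨hpos, ?_, ?_, ?_, ?_, ?_⟩
    · rw [hdet, ← FractionalIdeal.spanSingleton_mul_spanSingleton, h2,
        ← FractionalIdeal.spanSingleton_inv]
      have hs : FractionalIdeal.spanSingleton (𝓞 F)⁰ (ε : F) =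
        (𝔭 : FractionalIdeal (𝓞 F)⁰ F)⁻¹ * (t μ' * (t ν)⁻¹ : (FractionalIdeal (𝓞 F)⁰ F)ˣ) := by
        rw [← he, inv_mul_cancel_left₀ hP]
      rw [hs]
      simp only [Units.val_mul, Units.val_inv_eq_inv_val, Units.val_mk0]
      field_simp
    · rw [hval]; exact ha
    · rw [hval]
      refine mul_mem_of_le h4 hεi (le_of_eq ?_)
      simp only [Units.val_mul, Units.val_inv_eq_inv_val, Units.val_mk0]
      field_simp
    · rw [hval]; exact hc
    · rw [hval]
      refine mul_mem_of_le h6 hεi (le_of_eq ?_)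
      simp only [Units.val_mul, Units.val_inv_eq_inv_val, Units.val_mk0]
      field_simp
  rw [← inv_mul_cancel_right β (upperTri 0 ε),
    slash_mul k _ hpos (by rwa [det_upperTri]), hf _ _ _ _ hmem]

/-- For a maximal ideal `𝔭`, the quotient `J / 𝔭 J` of a fractional ideal is generated by one
element. -/
lemma exists_generator_mod (h𝔭 : 𝔭.IsMaximal) {J : FractionalIdeal (𝓞 F)⁰ F}
    (hJ : J ≠ 0) : ∃ j ∈ J, (∀ b ∈ J, ∃ x : 𝓞 F, b - x * j ∈ (𝔭 : FractionalIdeal (𝓞 F)⁰ F) * J) ∧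
      ∀ x : 𝓞 F, (x : F) * j ∈ (𝔭 : FractionalIdeal (𝓞 F)⁰ F) * J ↔ x ∈ 𝔭 := by
  obtain ⟨j, hj, hj'⟩ : ∃ j ∈ J, j ∉ (𝔭 : FractionalIdeal (𝓞 F)⁰ F) * J := by
    by_contra! h
    have hle : J ≤ (𝔭 : FractionalIdeal (𝓞 F)⁰ F) * J := h
    have := mul_right_cancel₀ hJ ((one_mul J).trans (le_antisymm hle (coeIdeal_mul_le 𝔭 J)))
    rw [eq_comm, FractionalIdeal.coeIdeal_eq_one] at this
    exact h𝔭.ne_top (this.trans Ideal.one_eq_top)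
  refine ⟨j, hj, fun b hb => ?_, fun x => ⟨fun hx => ?_, fun hx => ?_⟩⟩
  · obtain ⟨𝔠, -, h𝔠⟩ := exists_ideal_eq_spanSingleton_mul_inv (𝔞 := ⊤) (x := j) hJ (by simpa)
    obtain ⟨y, hy, hjy⟩ := exists_mul_sub_one_mem h𝔭 h𝔠 fun h => hj' (mem_of_ideal_le hJ h𝔠 h)
    obtain ⟨x, hx⟩ := (FractionalIdeal.mem_one_iff _).mp
      (mul_mem_of_le hy hb (inv_mul_cancel₀ hJ).le)
    refine ⟨x, ?_⟩
    have := mul_mem_of_le hjy hb le_rfl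
    convert this using 1
    rw [show (x : F) = y * b from hx]; ring
  · by_contra hx'
    obtain ⟨y, hy⟩ := h𝔭.exists_inv hx'
    refine hj' ?_
    obtain ⟨z, hz, hyz⟩ := hy
    have h1 : (y : F) ∈ (1 : FractionalIdeal (𝓞 F)⁰ F) := (FractionalIdeal.mem_one_iff _).mpr ⟨y, rfl⟩
    have := add_mem_fractionalIdeal (mul_mem_of_le h1 hx (one_mul _).le)
      (mul_mem_of_le (FractionalIdeal.mem_coeIdeal_of_mem (𝓞 F)⁰ hz) hj le_rfl)
    convert this using 1
    have : (y : F) * x + z = 1 := by exact_mod_cast congrArg (algebraMap (𝓞 F) F) hyz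
    rw [← mul_assoc, ← add_mul]
    exact (one_mul j).symm.trans (congrArg (· * j) this.symm)
  · exact mul_mem_of_le (FractionalIdeal.mem_coeIdeal_of_mem (𝓞 F)⁰ hx) hj le_rfl

/-- The Hecke operator `T_𝔭` in terms of upper triangular matrices. -/
lemma hecke_eq (ht : IsRepresentatives t) (h𝔫 : 𝔫 ≠ ⊥) (h𝔭 : 𝔭.IsMaximal) (h𝔭0 : 𝔭 ≠ ⊥)
    (h𝔭𝔫 : ¬ 𝔭 ∣ 𝔫) (hf : IsHilbertCuspForm t k 𝔫 f) (hχ : HasTrivialCharacter t k 𝔫 f)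
    {δ ε : Fˣ} (hδ : TotPos (δ : F)) (hε : TotPos (ε : F))
    (hd : FractionalIdeal.spanSingleton (𝓞 F)⁰ (δ : F) =
      (𝔭 : FractionalIdeal (𝓞 F)⁰ F) * (t μ * (t ν)⁻¹ : (FractionalIdeal (𝓞 F)⁰ F)ˣ))
    (he : (𝔭 : FractionalIdeal (𝓞 F)⁰ F) * FractionalIdeal.spanSingleton (𝓞 F)⁰ (ε : F) =
      (t μ' * (t ν)⁻¹ : (FractionalIdeal (𝓞 F)⁰ F)ˣ)) :
    ∃ B : 𝓞 F ⧸ 𝔭 → F, (∀ x, B x ∈ ((t ν : FractionalIdeal (𝓞 F)⁰ F) * different F)⁻¹) ∧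
      ∀ τ, hecke t k 𝔫 𝔭 f ν τ =
        (((Ideal.absNorm 𝔭 : ℝ) ^ ((maxWeight k : ℝ) / 2 - 1) : ℝ) : ℂ) *
          (slash k (f μ') (upperTri 0 ε) τ +
            ∑ᶠ x : 𝓞 F ⧸ 𝔭, slash k (f μ) (upperTri (B x) δ) τ) := by
  have hJ : ((t ν : FractionalIdeal (𝓞 F)⁰ F) * different F)⁻¹ ≠ 0 :=
    inv_ne_zero (mul_ne_zero (t ν).ne_zero different_ne_zero)
  have : Finite (𝓞 F ⧸ 𝔭) := Ideal.finiteQuotientOfFreeOfNeBot 𝔭 h𝔭0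
  obtain ⟨j, hj, hgen, hker⟩ := exists_generator_mod h𝔭 hJ
  have hone (x : 𝓞 F) : (x : F) ∈ (1 : FractionalIdeal (𝓞 F)⁰ F) :=
    (FractionalIdeal.mem_one_iff _).mpr ⟨x, rfl⟩
  have hB (x : 𝓞 F ⧸ 𝔭) : ((Quotient.out x : 𝓞 F) : F) * j ∈
      ((t ν : FractionalIdeal (𝓞 F)⁰ F) * different F)⁻¹ :=
    mul_mem_of_le (hone _) hj (one_mul _).le
  refine ⟨fun x => ((Quotient.out x : 𝓞 F) : F) * j, hB, fun τ => ?_⟩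
  obtain ⟨β₀, hβ₀⟩ := exists_mem_heckeSetDiv (t := t) (ν := ν) (μ := μ) h𝔫 h𝔭 h𝔭0 h𝔭𝔫 hδ
    δ.ne_zero hd
  rw [hecke, finsum_eq_single _ μ]
  · congr 1
    have hout {β : GL (Fin 2) F} (hβ : TotPos β.1.det) :
        slash k (f μ) (Quotient.out (Quotient.mk (QuotientGroup.rightRel (Gamma (t μ) 𝔫)) β)) =
          slash k (f μ) β := by
      refine slash_eq_of_mul_inv_mem (hf μ).slash_eq (fun γ hγ => hγ.1) hβ ?_
      exact QuotientGroup.rightRel_apply.mp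
        ((QuotientGroup.rightRel (Gamma (t μ) 𝔫)).symm (Quotient.mk_out (s := QuotientGroup.rightRel (Gamma (t μ) 𝔫)) β))
    let g : 𝓞 F ⧸ 𝔭 → Quotient (QuotientGroup.rightRel (Gamma (t μ) 𝔫)) := fun x =>
      Quotient.mk _ (upperTri (((Quotient.out x : 𝓞 F) : F) * j) δ)
    have hg : Function.Injective g := by
      intro x y hxy
      have h1 := QuotientGroup.rightRel_apply.mp (Quotient.exact hxy.symm)
      have h2 := sub_mem_of_upperTri_mul_inv_mem_Gamma hd h1
      rw [← sub_mul] at h2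
      have h3 := (hker (Quotient.out x - Quotient.out y)).mp (by simpa using h2)
      have := Ideal.Quotient.eq.mpr h3
      simpa [Ideal.Quotient.mk_out] using this
    -- The N(𝔭) + 1 cosets: the divisible one, and one for each residue of b.
    have himage : Quotient.mk (QuotientGroup.rightRel (Gamma (t μ) 𝔫)) '' heckeSet t 𝔫 𝔭 ν μ =
        insert (Quotient.mk _ β₀) (Set.range g) := by
      ext q
      constructor
      · rintro ⟨β, hβ, rfl⟩
        by_cases hdiv : β ∈ heckeSetDiv t 𝔫 𝔭 ν μ
        · left
          exact Quotient.sound (QuotientGroup.rightRel_apply.mpr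
            (mul_inv_mem_Gamma_of_mem_heckeSetDiv h𝔭0 hβ₀ hdiv))
        · right
          obtain ⟨b, hb, hbβ⟩ := exists_mul_inv_upperTri_mem_Gamma h𝔭 h𝔭0 h𝔭𝔫 hδ hd hβ hdiv
          obtain ⟨x, hx⟩ := hgen b hb
          refine ⟨Ideal.Quotient.mk 𝔭 x, Quotient.sound (QuotientGroup.rightRel_apply.mpr
            (hbβ _ ?_))⟩
          have h1 : x - Quotient.out (Ideal.Quotient.mk 𝔭 x) ∈ 𝔭 :=
            Ideal.Quotient.eq.mp (Ideal.Quotient.mk_out _).symm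
          have := add_mem_fractionalIdeal hx ((hker _).mpr h1)
          convert this using 1
          push_cast
          ring
      · rintro (rfl | ⟨x, rfl⟩)
        · exact ⟨β₀, hβ₀.1, rfl⟩
        · exact ⟨_, upperTri_mem_heckeSet hδ hd (hB x), rfl⟩
    have hnot : Quotient.mk (QuotientGroup.rightRel (Gamma (t μ) 𝔫)) β₀ ∉ Set.range g := by
      rintro ⟨x, hx⟩
      exact not_mem_heckeSetDiv_of_mul_mem h𝔭 hβ₀
        (QuotientGroup.rightRel_apply.mp (Quotient.exact hx.symm))
    rw [himage, finsum_mem_insert _ hnot (Set.finite_range g), finsum_mem_range hg,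
      hout hβ₀.1.1, slash_eq_of_mem_heckeSetDiv h𝔭0 hχ hε he hβ₀]
    congr 1
    refine finsum_congr fun x => ?_
    rw [hout (by rwa [det_upperTri])]
  · intro κ hκ
    -- A matrix β here would make det β / δ a totally positive generator of t_κt_μ⁻¹, forcing κ = μ.
    have hempty : heckeSet t 𝔫 𝔭 ν κ = ∅ := by
      rw [Set.eq_empty_iff_forall_notMem]
      intro β hβ
      refine hκ (ht.eq_of_eq_mul (x := Matrix.GeneralLinearGroup.det β * δ⁻¹) ?_ ?_)
      · have := hβ.1.mul hδ.inv
        simpa using this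
      · have h2 := hβ.2.1
        have hP : (𝔭 : FractionalIdeal (𝓞 F)⁰ F) ≠ 0 := FractionalIdeal.coeIdeal_ne_zero.mpr h𝔭0
        have hT := (t ν).ne_zero
        have hT' := (t μ).ne_zero
        rw [Units.val_mul, Units.val_inv_eq_inv_val, Matrix.GeneralLinearGroup.val_det_apply,
          ← FractionalIdeal.spanSingleton_mul_spanSingleton, ← FractionalIdeal.spanSingleton_inv,
          h2, hd]
        simp only [Units.val_mul, Units.val_inv_eq_inv_val]
        field_simp
    rw [hempty]
    simp

end HeckeOperator

/-! ### The Hecke recursion for the coefficients -/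

section Coefficients

variable {t : NarrowClassGroup F → (FractionalIdeal (𝓞 F)⁰ F)ˣ} {k : (F →+* ℝ) → ℕ}
  {𝔫 𝔭 : Ideal (𝓞 F)} {f : Family F} {ν μ μ' : NarrowClassGroup F}

/-- The weighted Fourier coefficient `a_ν(ξ) ξ^{-k/2}`. -/
noncomputable def weightedCoeff (k : (F →+* ℝ) → ℕ) (f : Family F) (ν : NarrowClassGroup F)
    (ξ : F) : ℂ :=
  fourierCoeff (f ν) ξ * ∏ σ : F →+* ℝ, (((σ ξ) ^ (-(k σ : ℝ) / 2) : ℝ) : ℂ)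

/-- The pair (ν, ξ) returned is the one chosen inside `coeffC`, so independence of that choice is
never needed. -/
lemma exists_coeffC_eq (ht : IsRepresentatives t) (f : Family F) {𝔪 : Ideal (𝓞 F)}
    (h𝔪 : 𝔪 ≠ ⊥) : ∃ (ν : NarrowClassGroup F) (ξ : Fˣ), TotPos (ξ : F) ∧
      (𝔪 : FractionalIdeal (𝓞 F)⁰ F) = FractionalIdeal.spanSingleton (𝓞 F)⁰ (ξ : F) *
        ((t ν)⁻¹ : (FractionalIdeal (𝓞 F)⁰ F)ˣ) ∧
      coeffC t k f 𝔪 = weightedCoeff k f ν ξ *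
        (((Ideal.absNorm 𝔪 : ℝ) ^ ((maxWeight k : ℝ) / 2) : ℝ) : ℂ) := by
  have hM : (𝔪 : FractionalIdeal (𝓞 F)⁰ F) ≠ 0 := FractionalIdeal.coeIdeal_ne_zero.mpr h𝔪
  have h : ∃ x : NarrowClassGroup F × F, TotPos x.2 ∧
      (𝔪 : FractionalIdeal (𝓞 F)⁰ F) = FractionalIdeal.spanSingleton (𝓞 F)⁰ x.2 *
        ((t x.1)⁻¹ : (FractionalIdeal (𝓞 F)⁰ F)ˣ) := by
    obtain ⟨ν, x, hx, hxν⟩ := ht.exists_eq_mul (Units.mk0 _ hM)⁻¹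
    refine ⟨(ν, (x : F)⁻¹), hx.inv, ?_⟩
    rw [← FractionalIdeal.spanSingleton_inv, Units.val_inv_eq_inv_val, ← mul_inv, ← hxν,
      Units.val_inv_eq_inv_val, inv_inv, Units.val_mk0]
  have h0 : h.choose.2 ≠ 0 := by
    intro h0
    have := h.choose_spec.2
    rw [h0, FractionalIdeal.spanSingleton_zero, zero_mul] at this
    exact hM this
  refine ⟨h.choose.1, Units.mk0 _ h0, h.choose_spec.1, h.choose_spec.2, ?_⟩
  rw [coeffC, dif_pos h]
  rfl

lemma weightedCoeff_eq_zero [IsTotallyReal F] (hf : IsHilbertCuspForm t k 𝔫 f) {ξ : F}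
    (hξ : ξ ∉ (t ν : FractionalIdeal (𝓞 F)⁰ F)) : weightedCoeff k f ν ξ = 0 := by
  rw [weightedCoeff, by_contra fun h => hξ
    ((hf ν).toIsModularForm.mem_of_fourierCoeff_ne_zero h), zero_mul]

lemma prod_rpow_mul {x y : F} (hx : TotPos x) (hy : TotPos y) :
    ∏ σ : F →+* ℝ, (((σ (x * y)) ^ (-(k σ : ℝ) / 2) : ℝ) : ℂ) =
      (∏ σ : F →+* ℝ, (((σ x) ^ (-(k σ : ℝ) / 2) : ℝ) : ℂ)) *
        ∏ σ : F →+* ℝ, (((σ y) ^ (-(k σ : ℝ) / 2) : ℝ) : ℂ) := by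
  rw [← Finset.prod_mul_distrib]
  refine Finset.prod_congr rfl fun σ _ => ?_
  rw [map_mul, Real.mul_rpow (hx σ).le (hy σ).le, Complex.ofReal_mul]

/-- The effect of `T_𝔭` on Fourier coefficients. -/
lemma eigenvalue_mul_weightedCoeff [IsTotallyReal F] (ht : IsRepresentatives t) (h𝔫 : 𝔫 ≠ ⊥)
    (h𝔭 : 𝔭.IsMaximal) (h𝔭0 : 𝔭 ≠ ⊥) (h𝔭𝔫 : ¬ 𝔭 ∣ 𝔫) (hf : IsHilbertCuspForm t k 𝔫 f)
    (hχ : HasTrivialCharacter t k 𝔫 f) {c : ℂ} (hc : hecke t k 𝔫 𝔭 f = c • f)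
    {δ ε : Fˣ} (hδ : TotPos (δ : F)) (hε : TotPos (ε : F))
    (hd : FractionalIdeal.spanSingleton (𝓞 F)⁰ (δ : F) =
      (𝔭 : FractionalIdeal (𝓞 F)⁰ F) * (t μ * (t ν)⁻¹ : (FractionalIdeal (𝓞 F)⁰ F)ˣ))
    (he : (𝔭 : FractionalIdeal (𝓞 F)⁰ F) * FractionalIdeal.spanSingleton (𝓞 F)⁰ (ε : F) =
      (t μ' * (t ν)⁻¹ : (FractionalIdeal (𝓞 F)⁰ F)ˣ)) {ζ : F} (hζ : TotPos ζ)
    (hζν : ζ ∈ (t ν : FractionalIdeal (𝓞 F)⁰ F)) :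
    c * weightedCoeff k f ν ζ =
      (((Ideal.absNorm 𝔭 : ℝ) ^ ((maxWeight k : ℝ) / 2 - 1) : ℝ) : ℂ) *
        (weightedCoeff k f μ' (ε * ζ) + Ideal.absNorm 𝔭 * weightedCoeff k f μ (δ * ζ)) := by
  classical
  have : Finite (𝓞 F ⧸ 𝔭) := Ideal.finiteQuotientOfFreeOfNeBot 𝔭 h𝔭0
  have := Fintype.ofFinite (𝓞 F ⧸ 𝔭)
  obtain ⟨B, hB, hB'⟩ := hecke_eq ht h𝔫 h𝔭 h𝔭0 h𝔭𝔫 hf hχ hδ hε hd he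
  have hsum := fun κ => (hf κ).toIsModularForm.hasSum_fourierCoeff
  have h1 (τ : HalfSpace F) := (((hasSum_slash_upperTri k (hsum μ') 0 hε τ).add
    (hasSum_sum (s := Finset.univ) fun x _ =>
      hasSum_slash_upperTri k (hsum μ) (B x) hδ τ)).mul_left
    (((Ideal.absNorm 𝔭 : ℝ) ^ ((maxWeight k : ℝ) / 2 - 1) : ℝ) : ℂ))
  simp_rw [← finsum_eq_sum_of_fintype, ← hB', finsum_eq_sum_of_fintype, hc, Pi.smul_apply,
    smul_eq_mul, ← Finset.sum_mul, ← add_mul, ← mul_assoc] at h1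
  have h2 (τ : HalfSpace F) := (hsum ν τ).mul_left c
  simp_rw [← mul_assoc] at h2
  -- Compare coefficients at ζ. Since ζ ∈ t_ν, every b-exponential is 1 and the sum over residues
  -- counts 𝓞/𝔭.
  have h3 := congrFun (hasSum_expTrace_unique h2 h1) ζ
  simp only [mul_zero, map_zero, Finset.sum_const_zero, Complex.ofReal_zero, Complex.exp_zero,
    mul_one, exp_trace_eq_one hζν (hB _), Finset.sum_const, Finset.card_univ, nsmul_eq_mul] at h3
  have hcard : (Fintype.card (𝓞 F ⧸ 𝔭) : ℂ) = Ideal.absNorm 𝔭 := by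
    rw [Ideal.absNorm_apply, Submodule.cardQuot_apply, Nat.card_eq_fintype_card]
  rw [hcard] at h3
  rw [weightedCoeff, ← mul_assoc, h3, weightedCoeff, weightedCoeff, prod_rpow_mul hε hζ,
    prod_rpow_mul hδ hζ]
  ring

/-- The Hecke recursion for a primitive form at a prime not dividing the level. -/
lemma IsPrimitive.normCoeff_recursion [IsTotallyReal F] (ht : IsRepresentatives t) (h𝔫 : 𝔫 ≠ ⊥)
    (h𝔭 : 𝔭.IsMaximal) (h𝔭0 : 𝔭 ≠ ⊥) (h𝔭𝔫 : ¬ 𝔭 ∣ 𝔫) (hf : IsPrimitive t k 𝔫 f) :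
    normCoeff t k f (𝔭 ^ 0) = 1 ∧ ∀ n : ℕ, normCoeff t k f (𝔭 ^ (n + 2)) =
      normCoeff t k f 𝔭 * normCoeff t k f (𝔭 ^ (n + 1)) - normCoeff t k f (𝔭 ^ n) := by
  have hP : (𝔭 : FractionalIdeal (𝓞 F)⁰ F) ≠ 0 := FractionalIdeal.coeIdeal_ne_zero.mpr h𝔭0
  have hcusp := hf.new.1
  obtain ⟨c, hc⟩ := hf.eigen 𝔭 h𝔭0
  choose ν ξ hξ hξν hcoeff using fun n : ℕ =>
    exists_coeffC_eq (k := k) ht f (pow_ne_zero n (show 𝔭 ≠ 0 from h𝔭0))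
  have hspan (n : ℕ) : FractionalIdeal.spanSingleton (𝓞 F)⁰ (ξ n : F) =
      (𝔭 : FractionalIdeal (𝓞 F)⁰ F) ^ n * t (ν n) := by
    rw [← FractionalIdeal.coeIdeal_pow, hξν n, mul_assoc, Units.inv_mul, mul_one]
  set N : ℝ := (Ideal.absNorm 𝔭 : ℝ) with hNdef
  have hN : 0 < N := by
    rw [hNdef]
    exact_mod_cast Nat.pos_of_ne_zero (Ideal.absNorm_eq_zero_iff.not.mpr h𝔭0)
  -- The exponent is n(k₀/2 - (k₀-1)/2) = n/2, so k₀ drops out.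
  have hnorm (n : ℕ) : normCoeff t k f (𝔭 ^ n) =
      weightedCoeff k f (ν n) (ξ n) * ((N ^ ((n : ℝ) / 2) : ℝ) : ℂ) := by
    have hNn : 0 < N ^ n := pow_pos hN n
    rw [normCoeff, hcoeff, map_pow, Nat.cast_pow, mul_div_assoc, ← Complex.ofReal_div,
      ← Real.rpow_sub hNn, ← Real.rpow_natCast N n, ← Real.rpow_mul hN.le]
    congr 4
    ring
  have hmem (n : ℕ) : (ξ n : F) ∈ (t (ν n) : FractionalIdeal (𝓞 F)⁰ F) := by
    have := mem_of_spanSingleton_eq (hspan n)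
    rw [← FractionalIdeal.coeIdeal_pow] at this
    exact coeIdeal_mul_le _ _ this
  have hpos (m n : ℕ) : TotPos ((ξ m * (ξ n)⁻¹ : Fˣ) : F) := by
    simpa using (hξ m).mul (hξ n).inv
  have hstep (n : ℕ) : FractionalIdeal.spanSingleton (𝓞 F)⁰ ((ξ (n + 1) * (ξ n)⁻¹ : Fˣ) : F) =
      (𝔭 : FractionalIdeal (𝓞 F)⁰ F) *
        (t (ν (n + 1)) * (t (ν n))⁻¹ : (FractionalIdeal (𝓞 F)⁰ F)ˣ) := by
    have hT := (t (ν n)).ne_zero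
    rw [Units.val_mul, Units.val_inv_eq_inv_val, ← FractionalIdeal.spanSingleton_mul_spanSingleton,
      ← FractionalIdeal.spanSingleton_inv, hspan, hspan, Units.val_mul, Units.val_inv_eq_inv_val, pow_succ]
    have hQ := pow_ne_zero n hP
    generalize (𝔭 : FractionalIdeal (𝓞 F)⁰ F) ^ n = Q at hQ ⊢
    field_simp
  have hone : weightedCoeff k f (ν 0) (ξ 0) = 1 := by
    have := hcoeff 0
    rw [pow_zero, Ideal.one_eq_top, hf.normalized] at this
    simpa using this.symm
  -- The relation at ξ₀, where the normalization enters. The ε-term vanishes: its frequency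
  -- generates 𝔭⁻¹t_μ, hence lies outside t_μ.
  have hc1 : c = ((N ^ ((maxWeight k : ℝ) / 2 - 1) : ℝ) : ℂ) *
      (N * weightedCoeff k f (ν 1) (ξ 1)) := by
    obtain ⟨μ, x, hx, hxμ⟩ := ht.exists_eq_mul (Units.mk0 _ hP * t (ν 0))
    rw [Units.val_mul, Units.val_mk0] at hxμ
    have hs : FractionalIdeal.spanSingleton (𝓞 F)⁰ (x : F) ≠ 0 :=
      FractionalIdeal.spanSingleton_ne_zero_iff.mpr x.ne_zero
    have hT := (t (ν 0)).ne_zero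
    have hT' := (t μ).ne_zero
    have he : (𝔭 : FractionalIdeal (𝓞 F)⁰ F) *
        FractionalIdeal.spanSingleton (𝓞 F)⁰ ((x⁻¹ : Fˣ) : F) =
        (t μ * (t (ν 0))⁻¹ : (FractionalIdeal (𝓞 F)⁰ F)ˣ) := by
      rw [Units.val_inv_eq_inv_val, ← FractionalIdeal.spanSingleton_inv, Units.val_mul,
        Units.val_inv_eq_inv_val, eq_mul_inv_iff_mul_eq₀ hT, mul_right_comm, hxμ, mul_right_comm,
        mul_inv_cancel₀ hs, one_mul]
    have hxi : TotPos ((x⁻¹ : Fˣ) : F) := by simpa using hx.inv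
    have h := eigenvalue_mul_weightedCoeff ht h𝔫 h𝔭 h𝔭0 h𝔭𝔫 hcusp hf.trivial_character hc
      (hpos 1 0) hxi (hstep 0) he (hξ 0) (hmem 0)
    have hzero : weightedCoeff k f μ ((x⁻¹ : Fˣ) * ξ 0) = 0 := by
      refine weightedCoeff_eq_zero hcusp fun hm => ?_
      rw [← FractionalIdeal.spanSingleton_le_iff_mem, ← FractionalIdeal.spanSingleton_mul_spanSingleton,
        hspan, pow_zero, one_mul, Units.val_inv_eq_inv_val, ← FractionalIdeal.spanSingleton_inv] at hm
      have h1 := mul_le_mul_right hm (FractionalIdeal.spanSingleton (𝓞 F)⁰ (x : F))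
      rw [mul_inv_cancel_left₀ hs, ← hxμ] at h1
      have h2 := mul_right_cancel₀ hT
        ((one_mul _).trans (le_antisymm h1 (coeIdeal_mul_le 𝔭 _)))
      rw [eq_comm, FractionalIdeal.coeIdeal_eq_one] at h2
      exact h𝔭.ne_top (h2.trans Ideal.one_eq_top)
    rw [hone, mul_one, hzero, zero_add, ← Units.val_mul, inv_mul_cancel_right] at h
    exact_mod_cast h
  -- The relation at ζ = ξ_(n+1), with ε and δ chosen so that εζ = ξ_n and δζ = ξ_(n+2).
  have hrec (n : ℕ) : N * weightedCoeff k f (ν 1) (ξ 1) * weightedCoeff k f (ν (n + 1)) (ξ (n + 1)) =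
      weightedCoeff k f (ν n) (ξ n) + N * weightedCoeff k f (ν (n + 2)) (ξ (n + 2)) := by
    have he : (𝔭 : FractionalIdeal (𝓞 F)⁰ F) *
        FractionalIdeal.spanSingleton (𝓞 F)⁰ ((ξ n * (ξ (n + 1))⁻¹ : Fˣ) : F) =
        (t (ν n) * (t (ν (n + 1)))⁻¹ : (FractionalIdeal (𝓞 F)⁰ F)ˣ) := by
      have hT := (t (ν n)).ne_zero
      have hT' := (t (ν (n + 1))).ne_zero
      rw [Units.val_mul, Units.val_inv_eq_inv_val, ← FractionalIdeal.spanSingleton_mul_spanSingleton,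
        ← FractionalIdeal.spanSingleton_inv, hspan, hspan, Units.val_mul, Units.val_inv_eq_inv_val, pow_succ]
      have hQ := pow_ne_zero n hP
      generalize (𝔭 : FractionalIdeal (𝓞 F)⁰ F) ^ n = Q at hQ ⊢
      field_simp
    have h := eigenvalue_mul_weightedCoeff ht h𝔫 h𝔭 h𝔭0 h𝔭𝔫 hcusp hf.trivial_character hc
      (hpos (n + 2) (n + 1)) (hpos n (n + 1)) (hstep (n + 1)) he (hξ (n + 1)) (hmem (n + 1))
    rw [← Units.val_mul, ← Units.val_mul, inv_mul_cancel_right, inv_mul_cancel_right, hc1,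
      mul_assoc] at h
    have hNp : ((N ^ ((maxWeight k : ℝ) / 2 - 1) : ℝ) : ℂ) ≠ 0 := by
      exact_mod_cast (Real.rpow_pos_of_pos hN _).ne'
    exact_mod_cast mul_left_cancel₀ hNp h
  refine ⟨by rw [hnorm, hone]; simp, fun n => ?_⟩
  have h1 : normCoeff t k f 𝔭 = normCoeff t k f (𝔭 ^ 1) := by rw [pow_one]
  have hs1 : N ^ (((n + 1 : ℕ) : ℝ) / 2) = N ^ ((n : ℝ) / 2) * N ^ ((1 : ℝ) / 2) := by
    rw [← Real.rpow_add hN]; congr 1; push_cast; ring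
  have hs2 : N ^ (((n + 2 : ℕ) : ℝ) / 2) = N ^ ((n : ℝ) / 2) * N := by
    nth_rewrite 3 [← Real.rpow_one N]
    rw [← Real.rpow_add hN]; congr 1; push_cast; ring
  have hs3 : (((N ^ ((1 : ℝ) / 2) : ℝ) : ℂ)) * ((N ^ ((1 : ℝ) / 2) : ℝ) : ℂ) = N := by
    rw [← Complex.ofReal_mul, ← Real.rpow_add hN]; norm_num
  rw [h1, hnorm, hnorm, hnorm, hnorm, hs1, hs2, Nat.cast_one]
  push_cast
  linear_combination ((N ^ ((n : ℝ) / 2) : ℝ) : ℂ) * (-hrec n) -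
    weightedCoeff k f (ν 1) (ξ 1) * weightedCoeff k f (ν (n + 1)) (ξ (n + 1)) *
      ((N ^ ((n : ℝ) / 2) : ℝ) : ℂ) * hs3

end Coefficients

/-! ### Sine estimates and the Chebyshev recursion -/

section Sine

lemma two_mul_le_sin_of_le_half {y : ℝ} (h0 : 0 ≤ y) (h1 : y ≤ 1 / 2) :
    2 * y ≤ Real.sin (Real.pi * y) := by
  have := Real.mul_le_sin (x := Real.pi * y) (by positivity) (by nlinarith [Real.pi_pos])
  convert this using 1
  field_simp

/-- Translating x by an integer changes only the sign of sin πx; on [0, 1/2] this is Jordan's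
inequality. -/
lemma two_mul_distInt_le_abs_sin (x : ℝ) : 2 * distInt x ≤ |Real.sin (Real.pi * x)| := by
  have h1 : |Real.sin (Real.pi * x)| = |Real.sin (Real.pi * (x - round x))| := by
    rw [mul_sub, mul_comm Real.pi (round x : ℝ), Real.sin_sub_int_mul_pi, abs_mul]
    simp
  have h2 : |Real.sin (Real.pi * (x - round x))| = Real.sin (Real.pi * distInt x) := by
    have hle := abs_sub_round x
    have hpos : 0 ≤ Real.sin (Real.pi * |x - round x|) := by
      have := two_mul_le_sin_of_le_half (abs_nonneg (x - round x)) hle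
      linarith [abs_nonneg (x - round x)]
    rw [distInt]
    rcases abs_choice (x - round x) with h | h
    · rw [h] at hpos ⊢; exact abs_of_nonneg hpos
    · rw [h] at hpos ⊢
      rw [mul_neg, Real.sin_neg] at hpos ⊢
      exact abs_of_nonpos (by linarith)
  rw [h1, h2]
  exact two_mul_le_sin_of_le_half (abs_nonneg _) (abs_sub_round x)

/-- Both sides satisfy the same recursion. Keeping sin θ as a factor avoids dividing by a quantity
that may be zero. -/
lemma sin_mul_eq_of_recursion {c : ℕ → ℂ} {θ : ℝ} (h0 : c 0 = 1)
    (h1 : c 1 = ((2 * Real.cos θ : ℝ) : ℂ))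
    (h : ∀ n, c (n + 2) = ((2 * Real.cos θ : ℝ) : ℂ) * c (n + 1) - c n) (n : ℕ) :
    (Real.sin θ : ℂ) * c n = (Real.sin ((n + 1 : ℝ) * θ) : ℂ) := by
  induction n using Nat.twoStepInduction with
  | zero => simp [h0]
  | one =>
    rw [h1]
    norm_cast
    rw [show ((1 + 1 : ℕ) : ℝ) * θ = 2 * θ by norm_num, Real.sin_two_mul]
    ring
  | more n ih1 ih2 =>
    rw [h n, mul_sub, mul_left_comm, ih1, ih2]
    norm_cast
    have e1 : ((n + 2 + 1 : ℕ) : ℝ) * θ = ((n + 1 + 1 : ℕ) : ℝ) * θ + θ := by push_cast; ring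
    have e2 : ((n + 1 : ℕ) : ℝ) * θ = ((n + 1 + 1 : ℕ) : ℝ) * θ - θ := by push_cast; ring
    rw [e1, e2, Real.sin_add, Real.sin_sub]
    ring

end Sine

end HilbertForm

/-! ### The lower bound -/

theorem mainTheorem5 {F : Type*} [Field F] [NumberField F] [NumberField.IsTotallyReal F]
    (t : HilbertForm.NarrowClassGroup F → (FractionalIdeal (𝓞 F)⁰ F)ˣ)
    (ht : HilbertForm.IsRepresentatives t)
    (k : (F →+* ℝ) → ℕ) (hk_even : ∀ σ, Even (k σ)) (hk : ∀ σ, 2 ≤ k σ)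
    (𝔫 : Ideal (𝓞 F)) (h𝔫 : 𝔫 ≠ ⊥)
    (f : HilbertForm.Family F) (hf : HilbertForm.IsPrimitive t k 𝔫 f)
    (𝔭 : Ideal (𝓞 F)) (h𝔭 : 𝔭.IsPrime) (h𝔭0 : 𝔭 ≠ ⊥) (h𝔭𝔫 : ¬ 𝔭 ∣ 𝔫)
    (θ : ℝ) (hθ : HilbertForm.IsHeckeAngle t k f 𝔭 θ)
    (hbad : HilbertForm.BadlyApproximable (θ / Real.pi)) :
    (∃ η : ℝ, 0 < η ∧ ∀ n : ℕ, 1 ≤ n →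
      η / ((n : ℝ) + 1) < ‖HilbertForm.normCoeff t k f (𝔭 ^ n)‖) ∧
    (∀ η : ℝ, HilbertForm.IsBadApproxConst η (θ / Real.pi) → ∀ n : ℕ, 1 ≤ n →
      η / ((n : ℝ) + 1) < ‖HilbertForm.normCoeff t k f (𝔭 ^ n)‖) := by
  have hbound : ∀ η : ℝ, HilbertForm.IsBadApproxConst η (θ / Real.pi) → ∀ n : ℕ, 1 ≤ n →
      η / ((n : ℝ) + 1) < ‖HilbertForm.normCoeff t k f (𝔭 ^ n)‖ := by
    intro η hη n _
    obtain ⟨h0, hrec⟩ := hf.normCoeff_recursion ht h𝔫 (h𝔭.isMaximal h𝔭0) h𝔭0 h𝔭𝔫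
    have hsin := HilbertForm.sin_mul_eq_of_recursion (c := fun n =>
      HilbertForm.normCoeff t k f (𝔭 ^ n)) (θ := θ) h0 (by simpa using hθ.2)
      (fun n => by rw [← hθ.2]; exact hrec n) n
    have hq := hη.2 (n + 1) (by omega)
    have hdist := HilbertForm.two_mul_distInt_le_abs_sin ((n + 1 : ℕ) * (θ / Real.pi))
    rw [show Real.pi * ((n + 1 : ℕ) * (θ / Real.pi)) = (n + 1 : ℝ) * θ by
      push_cast; field_simp] at hdist
    have hle : |Real.sin ((n + 1 : ℝ) * θ)| ≤ ‖HilbertForm.normCoeff t k f (𝔭 ^ n)‖ := by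
      have := congrArg norm hsin
      rw [norm_mul, Complex.norm_real, Complex.norm_real, Real.norm_eq_abs, Real.norm_eq_abs] at this
      rw [← this]
      exact mul_le_of_le_one_left (norm_nonneg _) (Real.abs_sin_le_one θ)
    have hpos : 0 < η / ((n + 1 : ℕ) : ℝ) := div_pos hη.1 (by positivity)
    push_cast at hq hpos hdist
    -- The chain gives the stronger bound 2η/(n+1); positivity of η lets the factor 2 be dropped.
    linarith
  obtain ⟨η, hη⟩ := hbad
  exact ⟨⟨η, hη.1, hbound η hη⟩, hbound⟩
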